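/- **Setting.** Let $(\Omega,d,\mu)$ be a connected metric space with a finite Borel measure $\mu$ carried by a separable set. For a Borel set $A$ put $\mu^+(A)=\liminf_{h\to0^+}\frac{\mu(A_h)-\mu(A)}{h}$, $A_h=\{x: d(x,A)<h\}$, and let $I_\Omega(t)=\inf\{\mu^+(A):A\text{ Borel},\ \mu(A)=t\}$ be the isoperimetric profile. For $f:\Omega\to\mathbb R$ let $|\nabla f|(x)=\limsup_{y\to x,\,y\ne x}\frac{|f(x)-f(y)|}{d(x,y)}$. The standing assumptions are: $I_\Omega$ is finite, continuous and concave on $[0,\mu(\Omega)]$, symmetric about $\mu(\Omega)/2$, with $I_\Omega(0)=0$; and for every Lipschitz $f$ and $c\in\mathbb R$, $|\nabla f|=0$ $\mu$-a.e. on $\{f=c\}$. For measurable $u:\Omega\to\mathbb R$ let $u^s_\mu(t)=\inf\{\lambda\in\mathbb R:\mu\{u>\lambda\}\le t\}$ be the signed decreasing rearrangement, $u^*_\mu(t)=\inf\{\lambda\ge0:\mu\{|u|>\lambda\}\le t\}$ the decreasing rearrangement, and $u^{ss}_\mu(t)=\frac1t\int_0^tu^s_\mu$, $u^{**}_\mu(t)=\frac1t\int_0^tu^*_\mu$.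 A rearrangement invariant (r.i.) space $X$ on $\Omega$ is a Banach function space with the Fatou property whose norm takes equal values at equimeasurable functions; $\varphi_X(t)=\|\chi_A\|_X$ with $\mu(A)=t$. Let $S_X$ be the set of Lipschitz $g$ with $\||\nabla g|\|_X<\infty$, and $$K(t,f;X,S_X)=\inf\{\|f-g\|_X+t\,\||\nabla g|\|_X:\ g\in S_X\}.$$ **Theorem.** (i) Suppose that $I_\Omega(t)>0$ for $0<t<\mu(\Omega)$. Then for every r.i. space $X$ and every $f\in X+S_X$, $f$ is integrable and, with $f_\Omega=\frac1{\mu(\Omega)}\int_\Omega f\,d\mu$, $$f^{ss}_\mu(t)-f^s_\mu(t)\le16\,\frac{K\!\left(\frac t{I_\Omega(t)},f;X,S_X\right)}{\varphi_X(t)},\qquad 0<t<\mu(\Omega)/2,$$ $$(f-f_\Omega)^{**}_\mu(t)-(f-f_\Omega)^*_\mu(t)\le16\,\frac{K\!\left(\frac t{I_\Omega(t)},f;X,S_X\right)}{\varphi_X(t)},\qquad 0<t<\mu(\Omega).$$ (ii) Conversely, let $G:(0,\mu(\Omega))\to[0,\infty)$ be continuous, concave and symmetric about $\mu(\Omega)/2$,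 and suppose that there is a constant $c>0$ such that for all integrable $f\in L^1+S_{L^1}$, $$f^{ss}_\mu(t)-f^s_\mu(t)\le c\,\frac{K\!\left(\frac t{G(t)},f;L^1,S_{L^1}\right)}t,\qquad 0<t<\mu(\Omega)/2.$$ Then there is a constant $c>0$ such that $G(t)\le c\,I_\Omega(t)$ for all $t\in(0,\mu(\Omega))$. -/

import Mathlib

open Set Filter Topology MeasureTheory
open scoped ENNReal NNReal

noncomputable section

/-- The modulus of the gradient of `f` at `x`, i.e. the upper limit of
`|f x - f y| / d(x, y)` as `y → x`, `y ≠ x`. -/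
def gradModulus {Ω : Type*} [MetricSpace Ω] (f : Ω → ℝ) (x : Ω) : ℝ≥0∞ :=
  limsup (fun y => edist (f x) (f y) / edist x y) (𝓝[≠] x)

/-- `f` belongs to `Lip(Ω)`. -/
def IsLip {Ω : Type*} [MetricSpace Ω] (f : Ω → ℝ) : Prop :=
  ∃ L : ℝ≥0, LipschitzWith L f

/-- The perimeter (Minkowski content) of `A`: the lower limit of
`(μ(A_h) - μ(A)) / h` as `h → 0+`, with `A_h = {x | d(x, A) < h}`. -/
def perimeter {Ω : Type*} [MetricSpace Ω] [MeasurableSpace Ω] (μ : Measure Ω)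
    (A : Set Ω) : ℝ≥0∞ :=
  liminf (fun h : ℝ => (μ (Metric.thickening h A) - μ A) / ENNReal.ofReal h) (𝓝[>] 0)

/-- The isoperimetric profile as an extended number: the infimum of the perimeters of
the Borel sets of measure `t` (`∞` if there are none). -/
def isoProfileENN {Ω : Type*} [MetricSpace Ω] [MeasurableSpace Ω] (μ : Measure Ω)
    (t : ℝ) : ℝ≥0∞ :=
  ⨅ (A : Set Ω) (_ : MeasurableSet A) (_ : μ A = ENNReal.ofReal t), perimeter μ A

/-- The isoperimetric profile as a real function. -/
def isoProfile {Ω : Type*} [MetricSpace Ω] [MeasurableSpace Ω] (μ : Measure Ω)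
    (t : ℝ) : ℝ :=
  (isoProfileENN μ t).toReal

/-- The standing assumptions on a connected metric space with a finite Borel measure. -/
structure StandardAssumptions {Ω : Type*} [MetricSpace Ω] [MeasurableSpace Ω]
    (μ : Measure Ω) : Prop where
  /-- The measure is carried by a separable set. -/
  separable : ∃ s : Set Ω, TopologicalSpace.IsSeparable s ∧ μ sᶜ = 0
  /-- The profile is finite, so that `isoProfile` is the profile. -/
  profile_finite : ∀ t ∈ Icc 0 (μ.real univ), isoProfileENN μ t ≠ ∞
  profile_continuous : ContinuousOn (isoProfile μ) (Icc 0 (μ.real univ))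
  profile_concave : ConcaveOn ℝ (Icc 0 (μ.real univ)) (isoProfile μ)
  profile_symm : ∀ t ∈ Icc 0 (μ.real univ), isoProfile μ (μ.real univ - t) = isoProfile μ t
  profile_zero : isoProfile μ 0 = 0
  /-- The gradient of a Lipschitz function vanishes almost everywhere on its level sets. -/
  grad_level : ∀ f : Ω → ℝ, IsLip f → ∀ c : ℝ, ∀ᵐ x ∂μ, f x = c → gradModulus f x = 0

/-- A rearrangement invariant Banach function norm with the Fatou property, as a functional on
the nonnegative `μ`-measurable functions. The space `X` consists of the `μ`-measurable `f`
with `ρ |f| < ∞`. -/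
structure IsRINorm {Ω : Type*} [MeasurableSpace Ω] (μ : Measure Ω)
    (ρ : (Ω → ℝ≥0∞) → ℝ≥0∞) : Prop where
  eq_zero_iff : ∀ f, AEMeasurable f μ → (ρ f = 0 ↔ f =ᵐ[μ] 0)
  smul : ∀ (a : ℝ≥0) (f), AEMeasurable f μ → ρ (fun x => (a : ℝ≥0∞) * f x) = a * ρ f
  add_le : ∀ f g, AEMeasurable f μ → AEMeasurable g μ → ρ (fun x => f x + g x) ≤ ρ f + ρ g
  mono : ∀ f g, AEMeasurable f μ → AEMeasurable g μ → f ≤ᵐ[μ] g → ρ f ≤ ρ g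
  fatou : ∀ f : ℕ → Ω → ℝ≥0∞, (∀ n, AEMeasurable (f n) μ) →
    (∀ᵐ x ∂μ, Monotone fun n => f n x) → ρ (fun x => ⨆ n, f n x) = ⨆ n, ρ (f n)
  indicator_lt_top : ∀ E, MeasurableSet E → μ E < ∞ → ρ (E.indicator 1) < ∞
  lintegral_le : ∀ E, MeasurableSet E → μ E < ∞ →
    ∃ C : ℝ≥0, ∀ f, AEMeasurable f μ → ∫⁻ x in E, f x ∂μ ≤ C * ρ f
  rearrangement_invariant : ∀ f g, AEMeasurable f μ → AEMeasurable g μ →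
    (∀ t, μ {x | t < f x} = μ {x | t < g x}) → ρ f = ρ g

/-- The `L¹(μ)` norm. -/
def normL1 {Ω : Type*} [MeasurableSpace Ω] (μ : Measure Ω) (f : Ω → ℝ≥0∞) : ℝ≥0∞ :=
  ∫⁻ x, f x ∂μ

/-- The fundamental function `φ_X(t) = ‖χ_A‖_X`, `μ(A) = t`; for a rearrangement
invariant norm the value does not depend on `A`, so the infimum is this common value. -/
def fundamentalFunction {Ω : Type*} [MeasurableSpace Ω] (μ : Measure Ω)
    (ρ : (Ω → ℝ≥0∞) → ℝ≥0∞) (t : ℝ) : ℝ≥0∞ :=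
  ⨅ (A : Set Ω) (_ : MeasurableSet A) (_ : μ A = ENNReal.ofReal t), ρ (A.indicator 1)

/-- `g ∈ S_X(Ω)`: `g` is Lipschitz and `‖|∇g|‖_X < ∞`. -/
def MemS {Ω : Type*} [MetricSpace Ω] (ρ : (Ω → ℝ≥0∞) → ℝ≥0∞) (g : Ω → ℝ) : Prop :=
  IsLip g ∧ ρ (gradModulus g) < ∞

/-- `f ∈ X(Ω) + S_X(Ω)`. -/
def MemXAddS {Ω : Type*} [MetricSpace Ω] [MeasurableSpace Ω] (μ : Measure Ω)
    (ρ : (Ω → ℝ≥0∞) → ℝ≥0∞) (f : Ω → ℝ) : Prop :=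
  AEMeasurable f μ ∧ ∃ g, MemS ρ g ∧ ρ (fun x => ‖f x - g x‖ₑ) < ∞

/-- Peetre's functional `K(t, f; X(Ω), S_X(Ω))`. -/
def KFunctional {Ω : Type*} [MetricSpace Ω] (ρ : (Ω → ℝ≥0∞) → ℝ≥0∞) (t : ℝ)
    (f : Ω → ℝ) : ℝ≥0∞ :=
  ⨅ (g : Ω → ℝ) (_ : MemS ρ g),
    ρ (fun x => ‖f x - g x‖ₑ) + ENNReal.ofReal t * ρ (gradModulus g)

/-- The decreasing rearrangement `u*` (of the absolute value of `u`). -/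
def decRearr {Ω : Type*} [MeasurableSpace Ω] (μ : Measure Ω) (u : Ω → ℝ) (s : ℝ) : ℝ :=
  sInf {t : ℝ | 0 ≤ t ∧ μ {x | t < |u x|} ≤ ENNReal.ofReal s}

/-- The maximal average `u**`. -/
def decRearrAvg {Ω : Type*} [MeasurableSpace Ω] (μ : Measure Ω) (u : Ω → ℝ) (t : ℝ) : ℝ :=
  (1 / t) * ∫ s in (0 : ℝ)..t, decRearr μ u s

/-- The signed decreasing rearrangement of `u`, the right-continuous non-increasing function
on `(0, μ(Ω))` that is equimeasurable with `u`. -/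
def signedRearr {Ω : Type*} [MeasurableSpace Ω] (μ : Measure Ω) (u : Ω → ℝ) (s : ℝ) : ℝ :=
  sInf {t : ℝ | μ {x | t < u x} ≤ ENNReal.ofReal s}

/-- The maximal average of the signed decreasing rearrangement. -/
def signedRearrAvg {Ω : Type*} [MeasurableSpace Ω] (μ : Measure Ω) (u : Ω → ℝ) (t : ℝ) : ℝ :=
  (1 / t) * ∫ s in (0 : ℝ)..t, signedRearr μ u s

end

/-! ### The gradient modulus: contractions, difference quotients, measurability. -/

section Gradient

variable {Ω : Type*} [MetricSpace Ω]

/-! Write M = μ(Ω) and I for the profile.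

For (i), take g Lipschitz, w = |f - g|, r = 3t/2, and cut at the levels b = g^s(r) and a = w*(t/4).
Since t + t/4 < r, f^s(t) ≥ b - a (`sub_le_signedRearr`). Hence t(f^ss - f^s)(t) is at most ∫(f - a
- b)₊ dμ + 2at, and (f - a - b)₊ ≤ (w - a)₊ + (g - b)₊. The terms in w are controlled by ∫₀ᵗ w*. For
(g - b)₊, the coarea inequality (`lintegral_perimeter_le`) and the monotonicity of I(s)/s bound
(I(r)/r)∫(g - b)₊ by the integral of |∇g| over {g > b}, hence by 2∫₀ᵗ|∇g|*; concavity gives I(t) ≤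
2I(r). This is `StandardAssumptions.oscillation_le`.

Its right side passes to norms through φ_X(t)∫₀ᵗ w* ≤ t‖w‖_X
(`IsRINorm.fundamentalFunction_mul_rearrInt_le`), proved by averaging a step function over cyclic
permutations of its steps. That argument needs a map carrying μ to Lebesgue measure, hence no atoms,
which follows from the assumption on level sets applied to distance functions. The infimum over g
then produces the K-functional. The second inequality of (i) is the same estimate for |f - f_Ω| and
|g - f_Ω| when t < M/2, and a Poincaré inequality around the median of g when t ≥ M/2.

For (ii), the hypothesis is tested at 2t on cut-offs of a set A of measure t. Their oscillation is
bounded below and their gradient integral is at most (μ(A_h) - μ(A))/h, so G(2t) ≤ 2c I(t) for t <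
M/4 (`StandardAssumptions.le_perimeter`); concavity and symmetry of G and I extend this to (0, M).
-/

theorem gradModulus_comp_le {F : ℝ → ℝ} (hF : LipschitzWith 1 F) (f : Ω → ℝ) (x : Ω) :
    gradModulus (fun y => F (f y)) x ≤ gradModulus f x := by
  refine limsup_le_limsup (Eventually.of_forall fun y => ?_)
  refine ENNReal.div_le_div_right ?_ _
  simpa using hF (f x) (f y)

theorem gradModulus_le {f : Ω → ℝ} {L : ℝ≥0} (hf : LipschitzWith L f) (x : Ω) :
    gradModulus f x ≤ L := by
  refine limsup_le_of_le (by isBoundedDefault) (Eventually.of_forall fun y => ?_)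
  exact ENNReal.div_le_of_le_mul (hf x y)

theorem gradModulus_lt_top {f : Ω → ℝ} (hf : IsLip f) (x : Ω) : gradModulus f x < ∞ := by
  obtain ⟨L, hL⟩ := hf
  exact (gradModulus_le hL x).trans_lt ENNReal.coe_lt_top

theorem IsLip.comp {F : ℝ → ℝ} (hF : LipschitzWith 1 F) {f : Ω → ℝ} (hf : IsLip f) :
    IsLip fun x => F (f x) := by
  obtain ⟨L, hL⟩ := hf
  exact ⟨1 * L, hF.comp hL⟩

theorem IsLip.continuous {f : Ω → ℝ} (hf : IsLip f) : Continuous f :=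
  hf.choose_spec.continuous

/-- The supremum of the difference quotients of `f` at `x` at distances less than `δ`. -/
noncomputable def slopeSup (f : Ω → ℝ) (δ : ℝ) (x : Ω) : ℝ≥0∞ :=
  ⨆ y ∈ Metric.ball x δ ∩ {x}ᶜ, edist (f x) (f y) / edist x y

theorem slopeSup_le {f : Ω → ℝ} {L : ℝ≥0} (hf : LipschitzWith L f) (δ : ℝ) (x : Ω) :
    slopeSup f δ x ≤ L :=
  iSup₂_le fun y _ => ENNReal.div_le_of_le_mul (hf x y)

theorem slopeSup_mono (f : Ω → ℝ) (x : Ω) : Monotone fun δ => slopeSup f δ x := by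
  intro δ δ' h
  exact biSup_mono fun y hy => ⟨Metric.ball_subset_ball h hy.1, hy.2⟩

theorem edist_le_slopeSup_mul {f : Ω → ℝ} {δ : ℝ} {x y : Ω} (h : dist x y < δ) (hne : y ≠ x) :
    edist (f x) (f y) ≤ slopeSup f δ x * edist x y := by
  have h1 : edist (f x) (f y) / edist x y ≤ slopeSup f δ x :=
    le_iSup₂_of_le (f := fun z _ => edist (f x) (f z) / edist x z) y
      ⟨by rwa [Metric.mem_ball, dist_comm], hne⟩ le_rfl
  rwa [ENNReal.div_le_iff (by simpa using hne.symm) (edist_ne_top _ _)] at h1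

theorem gradModulus_eq_iInf (f : Ω → ℝ) (x : Ω) :
    gradModulus f x = ⨅ n : ℕ, slopeSup f (1 / ((n : ℝ) + 1)) x := by
  have h := (Metric.nhds_basis_ball_inv_nat_succ (x := x)).inf_principal {x}ᶜ
  rw [gradModulus, nhdsWithin, h.limsup_eq_iInf_iSup]
  simp [slopeSup]

/-- The function is lower semicontinuous: a point `y` whose quotient at `x` exceeds `c` also serves
as a witness for all points near `x`. -/
theorem measurable_slopeSup [MeasurableSpace Ω] [BorelSpace Ω] {f : Ω → ℝ} (hf : Continuous f)
    (δ : ℝ) : Measurable (slopeSup f δ) := by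
  refine measurable_of_Ioi fun c => IsOpen.measurableSet ?_
  rw [isOpen_iff_mem_nhds]
  intro x hx
  simp only [mem_preimage, mem_Ioi, slopeSup, lt_iSup_iff] at hx
  obtain ⟨y, ⟨hy, hne⟩, hc⟩ := hx
  have hne' : x ≠ y := fun h => hne h.symm
  have h1 : Tendsto (fun x' => edist (f x') (f y) / edist x' y) (𝓝 x)
      (𝓝 (edist (f x) (f y) / edist x y)) := by
    refine ENNReal.Tendsto.div ?_ (Or.inr (by simpa using hne')) ?_ (Or.inl (edist_ne_top _ _))
    · exact (hf.edist continuous_const).tendsto x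
    · exact (continuous_id.edist continuous_const).tendsto x
  have h2 : ∀ᶠ x' in 𝓝 x, dist x' y < δ :=
    (continuous_id.dist continuous_const).tendsto x (Iio_mem_nhds (by
      simpa [dist_comm] using hy))
  filter_upwards [h1.eventually (lt_mem_nhds hc), h2, isOpen_ne.mem_nhds hne'] with x' h3 h4 h5
  simp only [mem_preimage, mem_Ioi, slopeSup, lt_iSup_iff]
  exact ⟨y, ⟨by rwa [Metric.mem_ball, dist_comm], Ne.symm h5⟩, h3⟩

theorem measurable_gradModulus [MeasurableSpace Ω] [BorelSpace Ω] {f : Ω → ℝ}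
    (hf : Continuous f) : Measurable (gradModulus f) := by
  have : gradModulus f = fun x => ⨅ n : ℕ, slopeSup f (1 / ((n : ℝ) + 1)) x :=
    funext (gradModulus_eq_iInf f)
  rw [this]
  exact Measurable.iInf fun n => measurable_slopeSup hf _

end Gradient

/-! ### The coarea inequality. -/

section Coarea

variable {Ω : Type*} [MetricSpace Ω] [MeasurableSpace Ω] [BorelSpace Ω]

/-- Fubini on the pairs `(x, s)` with `x` in the `δ`-neighbourhood of `{g > s}` but `g x ≤ s`: for
fixed `x`, such `s` exceed `g x` by less than `δ` times the slope at scale `δ`. Dividing by `δ` and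
letting `δ → 0` yields the coarea inequality. -/
theorem lintegral_thickening_diff_le (μ : Measure Ω) [IsFiniteMeasure μ] {g : Ω → ℝ}
    {L : ℝ≥0} (hg : LipschitzWith L g) {δ : ℝ} (hδ : 0 < δ) :
    Measurable (fun s : ℝ => μ (Metric.thickening δ {x | s < g x} \ {x | s < g x})) ∧
    ∫⁻ s : ℝ, μ (Metric.thickening δ {x | s < g x} \ {x | s < g x}) ≤
      ENNReal.ofReal δ * ∫⁻ x, slopeSup g δ x ∂μ := by
  set U : Set (Ω × ℝ) := {p | ∃ y, dist p.1 y < δ ∧ p.2 < g y} \ {p | p.2 < g p.1} with hU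
  have hUm : MeasurableSet U := by
    refine MeasurableSet.diff ?_ ?_
    · have : {p : Ω × ℝ | ∃ y, dist p.1 y < δ ∧ p.2 < g y} =
          ⋃ y, {p : Ω × ℝ | dist p.1 y < δ} ∩ {p : Ω × ℝ | p.2 < g y} := by
        ext p; simp
      rw [this]
      refine (isOpen_iUnion fun y => IsOpen.inter ?_ ?_).measurableSet
      · exact isOpen_lt (continuous_fst.dist continuous_const) continuous_const
      · exact isOpen_lt continuous_snd continuous_const
    · exact (isOpen_lt continuous_snd (hg.continuous.comp continuous_fst)).measurableSet
  have hslice : ∀ s : ℝ, (fun x => (x, s)) ⁻¹' U =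
      Metric.thickening δ {x | s < g x} \ {x | s < g x} := by
    intro s
    ext x
    simp [hU, Metric.mem_thickening_iff, and_comm]
  constructor
  · simp_rw [← hslice]
    exact measurable_measure_prodMk_right hUm
  calc ∫⁻ s : ℝ, μ (Metric.thickening δ {x | s < g x} \ {x | s < g x})
      = (μ.prod volume) U := by
        rw [Measure.prod_apply_symm hUm]
        simp_rw [hslice]
    _ = ∫⁻ x, volume (Prod.mk x ⁻¹' U) ∂μ := Measure.prod_apply hUm
    _ ≤ ∫⁻ x, ENNReal.ofReal δ * slopeSup g δ x ∂μ := by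
        refine lintegral_mono fun x => ?_
        have hfin : slopeSup g δ x ≠ ∞ := ((slopeSup_le hg δ x).trans_lt ENNReal.coe_lt_top).ne
        have hsub : Prod.mk x ⁻¹' U ⊆ Ico (g x) (g x + δ * (slopeSup g δ x).toReal) := by
          rintro s ⟨⟨y, hy, hs⟩, hs'⟩
          simp only [mem_ofPred_eq, not_lt] at hs' hs hy
          refine ⟨hs', ?_⟩
          have hne : y ≠ x := by rintro rfl; linarith
          have h1 := ENNReal.toReal_mono (ENNReal.mul_ne_top hfin (edist_ne_top x y))
            (edist_le_slopeSup_mul (f := g) hy hne)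
          rw [ENNReal.toReal_mul, edist_dist, edist_dist, ENNReal.toReal_ofReal dist_nonneg,
            ENNReal.toReal_ofReal dist_nonneg, Real.dist_eq] at h1
          have h2 := neg_abs_le (g x - g y)
          nlinarith [ENNReal.toReal_nonneg (a := slopeSup g δ x)]
        calc volume (Prod.mk x ⁻¹' U) ≤ volume (Ico (g x) (g x + δ * (slopeSup g δ x).toReal)) :=
              measure_mono hsub
          _ = _ := by
            rw [Real.volume_Ico, add_sub_cancel_left, ENNReal.ofReal_mul hδ.le,
              ENNReal.ofReal_toReal hfin]
    _ = _ := lintegral_const_mul _ (measurable_slopeSup hg.continuous δ)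

/-- The coarea inequality. -/
theorem lintegral_perimeter_le (μ : Measure Ω) [IsFiniteMeasure μ] {g : Ω → ℝ} (hg : IsLip g) :
    ∫⁻ s : ℝ, perimeter μ {x | s < g x} ≤ ∫⁻ x, gradModulus g x ∂μ := by
  obtain ⟨L, hL⟩ := hg
  set δ : ℕ → ℝ := fun n => 1 / ((n : ℝ) + 1) with hδ
  have hδ0 : ∀ n, 0 < δ n := fun n => Nat.one_div_pos_of_nat
  have hδt : Tendsto δ atTop (𝓝[>] 0) :=
    tendsto_nhdsWithin_iff.2 ⟨tendsto_one_div_add_atTop_nhds_zero_nat,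
      Eventually.of_forall hδ0⟩
  set q : ℕ → ℝ → ℝ≥0∞ := fun n s =>
    μ (Metric.thickening (δ n) {x | s < g x} \ {x | s < g x}) / ENNReal.ofReal (δ n) with hq
  have hqm : ∀ n, Measurable (q n) := fun n =>
    (lintegral_thickening_diff_le μ hL (hδ0 n)).1.div_const _
  have hqi : ∀ n, ∫⁻ s, q n s ≤ ∫⁻ x, slopeSup g (δ n) x ∂μ := by
    intro n
    simp only [hq, div_eq_mul_inv]
    rw [lintegral_mul_const _ (lintegral_thickening_diff_le μ hL (hδ0 n)).1, ← div_eq_mul_inv]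
    refine ENNReal.div_le_of_le_mul ?_
    rw [mul_comm]
    exact (lintegral_thickening_diff_le μ hL (hδ0 n)).2
  have hper : ∀ s, perimeter μ {x | s < g x} ≤ liminf (fun n => q n s) atTop := by
    intro s
    refine (liminf_le_liminf_of_le hδt).trans ?_
    exact liminf_le_liminf (Eventually.of_forall fun n =>
      ENNReal.div_le_div_right le_measure_sdiff _)
  have hanti : Antitone fun n => slopeSup g (δ n) := fun m n hmn x =>
    slopeSup_mono g x (Nat.one_div_le_one_div hmn)
  -- Fatou's lemma in `s`, then monotone convergence in `x`; the Lipschitz bound provides the finite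
  -- integral needed for a decreasing sequence.
  calc ∫⁻ s : ℝ, perimeter μ {x | s < g x} ≤ ∫⁻ s, liminf (fun n => q n s) atTop :=
        lintegral_mono hper
    _ ≤ liminf (fun n => ∫⁻ s, q n s) atTop := lintegral_liminf_le hqm
    _ ≤ ⨅ n, ∫⁻ x, slopeSup g (δ n) x ∂μ := by
        refine le_iInf fun k => ?_
        refine liminf_le_of_frequently_le' ?_
        refine Eventually.frequently ?_
        filter_upwards [eventually_ge_atTop k] with n hn
        exact (hqi n).trans (lintegral_mono (hanti hn))
    _ = ∫⁻ x, ⨅ n, slopeSup g (δ n) x ∂μ := by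
        refine (lintegral_iInf (fun n => measurable_slopeSup hL.continuous _) hanti ?_).symm
        refine ((lintegral_mono (slopeSup_le hL _)).trans_lt ?_).ne
        simp [ENNReal.mul_lt_top_iff, measure_lt_top]
    _ = _ := by simp_rw [gradModulus_eq_iInf]; rfl

end Coarea

/-! ### Consequences of concavity of the profile, and a Sobolev inequality. -/

section Profile

variable {Ω : Type*} [MetricSpace Ω] [MeasurableSpace Ω] {μ : Measure Ω}

theorem isoProfile_nonneg (t : ℝ) : 0 ≤ isoProfile μ t := ENNReal.toReal_nonneg

theorem StandardAssumptions.concave_le (hμ : StandardAssumptions μ) {x y a b : ℝ}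
    (hx : x ∈ Icc 0 (μ.real univ)) (hy : y ∈ Icc 0 (μ.real univ)) (ha : 0 ≤ a) (hb : 0 ≤ b)
    (hab : a + b = 1) :
    a * isoProfile μ x + b * isoProfile μ y ≤ isoProfile μ (a * x + b * y) := by
  have h := hμ.profile_concave.2 hx hy ha hb hab
  simpa only [smul_eq_mul] using h

/-- A concave function vanishing at 0 lies above its chord from the origin. -/
theorem StandardAssumptions.isoProfile_ge (hμ : StandardAssumptions μ) {m r : ℝ} (hm : 0 ≤ m)
    (hmr : m ≤ r) (hr : 0 < r) (hrM : r ≤ μ.real univ) :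
    isoProfile μ r / r * m ≤ isoProfile μ m := by
  have h := hμ.concave_le (x := 0) (y := r) ⟨le_rfl, hr.le.trans hrM⟩ ⟨hr.le, hrM⟩
    (a := 1 - m / r) (b := m / r) (by rw [sub_nonneg, div_le_one hr]; exact hmr)
    (by positivity) (by ring)
  simp only [mul_zero, zero_add, hμ.profile_zero] at h
  rw [div_mul_cancel₀ _ hr.ne'] at h
  calc isoProfile μ r / r * m = m / r * isoProfile μ r := by ring
    _ ≤ _ := h

theorem StandardAssumptions.isoProfile_le_half (hμ : StandardAssumptions μ) {t : ℝ}
    (ht : t ∈ Icc 0 (μ.real univ)) : isoProfile μ t ≤ isoProfile μ (μ.real univ / 2) := by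
  have h := hμ.concave_le (x := t) (y := μ.real univ - t) ht
    ⟨by linarith [ht.2], by linarith [ht.1]⟩ (a := 1 / 2) (b := 1 / 2) (by norm_num)
    (by norm_num) (by norm_num)
  simp only [hμ.profile_symm t ht] at h
  rw [show 1 / 2 * t + 1 / 2 * (μ.real univ - t) = μ.real univ / 2 by ring] at h
  linarith

/-- The point 3t/2 lies on the segment from t to M with weight at most 1/2 at M, where the profile
vanishes. With 2t instead of 3t/2 no such constant would exist as t approaches M/2. -/
theorem StandardAssumptions.isoProfile_le_two_mul (hμ : StandardAssumptions μ) {t : ℝ}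
    (ht : t ∈ Ioo 0 (μ.real univ / 2)) : isoProfile μ t ≤ 2 * isoProfile μ (3 / 2 * t) := by
  obtain ⟨h0, h1⟩ := ht
  set M := μ.real univ
  have hMt : 0 < M - t := by linarith
  have hM : isoProfile μ M = 0 := by
    have := hμ.profile_symm 0 ⟨le_rfl, by linarith⟩
    rwa [sub_zero, hμ.profile_zero] at this
  have hθ : t / 2 / (M - t) ≤ 1 / 2 := by rw [div_le_iff₀ hMt]; linarith
  have h := hμ.concave_le (x := t) (y := M) ⟨h0.le, by linarith⟩ ⟨by linarith, le_rfl⟩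
    (a := 1 - t / 2 / (M - t)) (b := t / 2 / (M - t)) (by linarith) (by positivity) (by ring)
  simp only [hM, mul_zero, add_zero] at h
  rw [show (1 - t / 2 / (M - t)) * t + t / 2 / (M - t) * M = 3 / 2 * t by field_simp; ring] at h
  nlinarith [isoProfile_nonneg (μ := μ) t]

theorem StandardAssumptions.mul_le_perimeter [IsFiniteMeasure μ] (hμ : StandardAssumptions μ)
    {A : Set Ω} (hA : MeasurableSet A) {r : ℝ} (hr : 0 < r) (hrM : r ≤ μ.real univ)
    (hAr : μ A ≤ ENNReal.ofReal r) :
    ENNReal.ofReal (isoProfile μ r / r) * μ A ≤ perimeter μ A := by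
  have hfin : μ A ≠ ∞ := measure_ne_top μ A
  have h0 : μ.real A ≤ r := ENNReal.toReal_le_of_le_ofReal hr.le hAr
  have h1 : μ.real A ∈ Icc 0 (μ.real univ) := ⟨measureReal_nonneg, h0.trans hrM⟩
  calc ENNReal.ofReal (isoProfile μ r / r) * μ A
      = ENNReal.ofReal (isoProfile μ r / r * μ.real A) := by
        rw [ENNReal.ofReal_mul (div_nonneg (isoProfile_nonneg r) hr.le), measureReal_def,
          ENNReal.ofReal_toReal hfin]
    _ ≤ ENNReal.ofReal (isoProfile μ (μ.real A)) :=
        ENNReal.ofReal_le_ofReal (hμ.isoProfile_ge h1.1 h0 hr hrM)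
    _ = isoProfileENN μ (μ.real A) := ENNReal.ofReal_toReal (hμ.profile_finite _ h1)
    _ ≤ perimeter μ A := iInf_le_of_le A (iInf_le_of_le hA (iInf_le_of_le
        (by rw [measureReal_def, ENNReal.ofReal_toReal hfin]) le_rfl))

theorem lipschitzWith_sub_max (b : ℝ) : LipschitzWith 1 fun y : ℝ => max (y - b) 0 := by
  have h : LipschitzWith 1 fun y : ℝ => y - b := by
    simpa using LipschitzWith.id.sub (LipschitzWith.const b)
  exact h.max_const 0

/-- The Sobolev inequality for the part of `g` above a level. -/
theorem StandardAssumptions.lintegral_sub_le [BorelSpace Ω] [IsFiniteMeasure μ]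
    (hμ : StandardAssumptions μ) {g : Ω → ℝ} (hg : IsLip g) {b r : ℝ} (hr : 0 < r)
    (hrM : r ≤ μ.real univ) (hb : μ {x | b < g x} ≤ ENNReal.ofReal r) :
    ENNReal.ofReal (isoProfile μ r / r) * ∫⁻ x, ENNReal.ofReal (g x - b) ∂μ ≤
      ∫⁻ x in {x | b < g x}, gradModulus g x ∂μ := by
  set u : Ω → ℝ := fun x => max (g x - b) 0 with hu
  have huL : IsLip u := hg.comp (lipschitzWith_sub_max b)
  have hset : MeasurableSet {x | b < g x} :=
    measurableSet_lt measurable_const hg.continuous.measurable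
  have h1 : ∫⁻ x, ENNReal.ofReal (g x - b) ∂μ = ∫⁻ s in Ioi (0 : ℝ), μ {x | s < u x} := by
    rw [← lintegral_eq_lintegral_meas_lt μ (f := u) (Eventually.of_forall fun x => le_max_right _ _)
      huL.continuous.measurable.aemeasurable]
    refine lintegral_congr fun x => ?_
    rw [ENNReal.ofReal_max, ENNReal.ofReal_zero, max_eq_left (zero_le)]
  rw [h1, ← lintegral_const_mul' _ _ ENNReal.ofReal_ne_top]
  calc ∫⁻ s in Ioi (0 : ℝ), ENNReal.ofReal (isoProfile μ r / r) * μ {x | s < u x}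
      ≤ ∫⁻ s in Ioi (0 : ℝ), perimeter μ {x | s < u x} := by
        refine setLIntegral_mono' measurableSet_Ioi fun s hs => ?_
        refine hμ.mul_le_perimeter (measurableSet_lt measurable_const
          huL.continuous.measurable) hr hrM ((measure_mono fun x hx => ?_).trans hb)
        simp only [hu, mem_ofPred_eq, lt_max_iff] at hx ⊢
        rcases hx with h | h
        · linarith [mem_Ioi.1 hs]
        · exact absurd h (not_lt.2 (mem_Ioi.1 hs).le)
    _ ≤ ∫⁻ s : ℝ, perimeter μ {x | s < u x} := setLIntegral_le_lintegral _ _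
    _ ≤ ∫⁻ x, gradModulus u x ∂μ := lintegral_perimeter_le μ huL
    _ ≤ ∫⁻ x, {x | b < g x}.indicator (gradModulus g) x ∂μ := by
        refine lintegral_mono_ae ?_
        -- Off `{b < g}` the truncation `u` is zero, so the assumption on level sets removes the
        -- gradient there, including on `{g = b}`.
        filter_upwards [hμ.grad_level u huL 0] with x hx
        by_cases hxb : b < g x
        · rw [indicator_of_mem (by exact hxb)]
          exact gradModulus_comp_le (lipschitzWith_sub_max b) g x
        · rw [hx (max_eq_right (by linarith))]
          exact zero_le
    _ = _ := lintegral_indicator hset _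

end Profile

/-! ### Signed rearrangements and equimeasurability. -/

section Rearrangement

variable {Ω : Type*} [MeasurableSpace Ω] {μ : Measure Ω}

theorem ext_of_Ioi {ν₁ ν₂ : Measure ℝ} [IsFiniteMeasure ν₁] [IsFiniteMeasure ν₂]
    (hu : ν₁ univ = ν₂ univ) (h : ∀ a, ν₁ (Ioi a) = ν₂ (Ioi a)) : ν₁ = ν₂ := by
  refine Measure.ext_of_Iic _ _ fun a => ?_
  rw [← compl_Ioi, measure_compl measurableSet_Ioi (measure_ne_top _ _),
    measure_compl measurableSet_Ioi (measure_ne_top _ _), hu, h a]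

theorem measure_lt_le_of_forall_gt {f : Ω → ℝ} {y : ℝ} {m : ℝ≥0∞}
    (h : ∀ z, y < z → μ {x | z < f x} ≤ m) : μ {x | y < f x} ≤ m := by
  have hmono : Monotone fun n : ℕ => {x | y + 1 / ((n : ℝ) + 1) < f x} := by
    intro i j hij x hx
    simp only [mem_ofPred_eq] at hx ⊢
    linarith [Nat.one_div_le_one_div (α := ℝ) hij]
  have hU : {x | y < f x} = ⋃ n : ℕ, {x | y + 1 / ((n : ℝ) + 1) < f x} := by
    ext x
    simp only [mem_ofPred_eq, mem_iUnion]
    constructor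
    · intro hx
      obtain ⟨n, hn⟩ := exists_nat_one_div_lt (sub_pos.2 hx)
      exact ⟨n, by linarith⟩
    · rintro ⟨n, hn⟩
      linarith [Nat.one_div_pos_of_nat (α := ℝ) (n := n)]
  rw [hU, hmono.measure_iUnion]
  exact iSup_le fun n => h _ (by linarith [Nat.one_div_pos_of_nat (α := ℝ) (n := n)])

/-- The integral of the decreasing rearrangement of a nonnegative function over `(0, t)`. -/
noncomputable def rearrInt (μ : Measure Ω) (w : Ω → ℝ) (t : ℝ) : ℝ≥0∞ :=
  ∫⁻ s in Ioo 0 t, ENNReal.ofReal (signedRearr μ w s)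

theorem rearrInt_mono (w : Ω → ℝ) {s t : ℝ} (h : s ≤ t) : rearrInt μ w s ≤ rearrInt μ w t :=
  lintegral_mono_set (Ioo_subset_Ioo_right h)

variable [IsFiniteMeasure μ]

theorem exists_measure_lt_le {f : Ω → ℝ} (hf : AEMeasurable f μ) {s : ℝ} (hs : 0 < s) :
    ∃ y, μ {x | y < f x} ≤ ENNReal.ofReal s := by
  have h : Tendsto (fun n : ℕ => μ {x | (n : ℝ) < f x}) atTop
      (𝓝 (μ (⋂ n : ℕ, {x | (n : ℝ) < f x}))) := by
    refine tendsto_measure_iInter_atTop (fun n => nullMeasurableSet_lt aemeasurable_const hf)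
      (fun i j hij x hx => ?_) ⟨0, measure_ne_top _ _⟩
    simp only [mem_ofPred_eq] at hx ⊢
    exact lt_of_le_of_lt (Nat.cast_le.2 hij) hx
  have h0 : (⋂ n : ℕ, {x | (n : ℝ) < f x}) = ∅ := by
    refine eq_empty_of_forall_notMem fun x hx => ?_
    obtain ⟨n, hn⟩ := exists_nat_gt (f x)
    exact lt_asymm hn (mem_iInter.1 hx n)
  rw [h0, measure_empty] at h
  obtain ⟨n, hn⟩ := (h.eventually (ge_mem_nhds (ENNReal.ofReal_pos.2 hs))).exists
  exact ⟨n, hn⟩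

theorem exists_lt_measure_lt (f : Ω → ℝ) {s : ℝ} (hs : s ∈ Ioo 0 (μ.real univ)) :
    ∃ y, ENNReal.ofReal s < μ {x | y < f x} := by
  have hmono : Monotone fun n : ℕ => {x | -(n : ℝ) < f x} := by
    intro i j hij x hx
    simp only [mem_ofPred_eq] at hx ⊢
    linarith [(Nat.cast_le (α := ℝ)).2 hij]
  have hU : (⋃ n : ℕ, {x | -(n : ℝ) < f x}) = univ := by
    refine eq_univ_of_forall fun x => mem_iUnion.2 ?_
    obtain ⟨n, hn⟩ := exists_nat_gt (-f x)
    exact ⟨n, by simp only [mem_ofPred_eq]; linarith⟩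
  have h : ENNReal.ofReal s < μ (⋃ n : ℕ, {x | -(n : ℝ) < f x}) := by
    rw [hU, ENNReal.ofReal_lt_iff_lt_toReal hs.1.le (measure_ne_top _ _)]
    exact hs.2
  rw [hmono.measure_iUnion, lt_iSup_iff] at h
  obtain ⟨n, hn⟩ := h
  exact ⟨_, hn⟩

/-- The infimum is attained because the distribution function is right-continuous. The open interval
matters: at 0 the defining set may be empty, and from M on it is all of ℝ, so `sInf` takes its
default value. -/
theorem lt_signedRearr_iff {f : Ω → ℝ} (hf : AEMeasurable f μ) {s : ℝ}
    (hs : s ∈ Ioo 0 (μ.real univ)) (y : ℝ) :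
    y < signedRearr μ f s ↔ ENNReal.ofReal s < μ {x | y < f x} := by
  have hne : {t : ℝ | μ {x | t < f x} ≤ ENNReal.ofReal s}.Nonempty := exists_measure_lt_le hf hs.1
  have hup : ∀ {a b : ℝ}, a ≤ b → μ {x | b < f x} ≤ μ {x | a < f x} := fun hab =>
    measure_mono fun x hx => lt_of_le_of_lt hab hx
  have hbdd : BddBelow {t : ℝ | μ {x | t < f x} ≤ ENNReal.ofReal s} := by
    obtain ⟨z, hz⟩ := exists_lt_measure_lt f hs
    refine ⟨z, fun t ht => ?_⟩
    by_contra! h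
    exact absurd (hz.trans_le (hup h.le)) (not_lt.2 ht)
  constructor
  · intro h
    by_contra! h'
    exact absurd (csInf_le hbdd h') (not_le.2 h)
  · contrapose!
    intro h
    refine measure_lt_le_of_forall_gt fun z hz => ?_
    obtain ⟨t, ht, htz⟩ := exists_lt_of_csInf_lt hne (lt_of_le_of_lt h hz)
    exact (hup htz.le).trans ht

theorem signedRearr_le_iff {f : Ω → ℝ} (hf : AEMeasurable f μ) {s : ℝ}
    (hs : s ∈ Ioo 0 (μ.real univ)) (y : ℝ) :
    signedRearr μ f s ≤ y ↔ μ {x | y < f x} ≤ ENNReal.ofReal s := by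
  simpa only [not_lt] using not_congr (lt_signedRearr_iff hf hs y)

theorem antitoneOn_signedRearr {f : Ω → ℝ} (hf : AEMeasurable f μ) :
    AntitoneOn (signedRearr μ f) (Ioo 0 (μ.real univ)) := by
  intro s hs t ht hst
  rw [signedRearr_le_iff hf ht]
  exact ((signedRearr_le_iff hf hs _).1 le_rfl).trans (ENNReal.ofReal_le_ofReal hst)

theorem signedRearr_nonneg {f : Ω → ℝ} (hf : AEMeasurable f μ) (h0 : ∀ x, 0 ≤ f x) {s : ℝ}
    (hs : s ∈ Ioo 0 (μ.real univ)) : 0 ≤ signedRearr μ f s := by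
  refine le_of_forall_lt fun y hy => ?_
  rw [lt_signedRearr_iff hf hs, ENNReal.ofReal_lt_iff_lt_toReal hs.1.le (measure_ne_top _ _)]
  rw [show {x | y < f x} = univ from eq_univ_of_forall fun x => hy.trans_le (h0 x)]
  exact hs.2

theorem aemeasurable_signedRearr {f : Ω → ℝ} (hf : AEMeasurable f μ) :
    AEMeasurable (signedRearr μ f) (volume.restrict (Ioo 0 (μ.real univ))) :=
  aemeasurable_restrict_of_antitoneOn measurableSet_Ioo (antitoneOn_signedRearr hf)

/-- The superlevel set of the rearrangement is the interval from 0 to the measure of the superlevel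
set of `f`. -/
theorem volume_lt_signedRearr {f : Ω → ℝ} (hf : AEMeasurable f μ) (y : ℝ) :
    volume ({s | y < signedRearr μ f s} ∩ Ioo 0 (μ.real univ)) = μ {x | y < f x} := by
  have hset : {s | y < signedRearr μ f s} ∩ Ioo 0 (μ.real univ) =
      Ioo 0 (μ.real {x | y < f x}) := by
    ext s
    constructor
    · rintro ⟨h1, h2⟩
      have h3 := (lt_signedRearr_iff hf h2 y).1 h1
      exact ⟨h2.1, (ENNReal.ofReal_lt_iff_lt_toReal h2.1.le (measure_ne_top _ _)).1 h3⟩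
    · rintro ⟨h1, h2⟩
      have h3 : s ∈ Ioo 0 (μ.real univ) := ⟨h1, h2.trans_le (measureReal_mono (subset_univ _))⟩
      exact ⟨(lt_signedRearr_iff hf h3 y).2
        ((ENNReal.ofReal_lt_iff_lt_toReal h1.le (measure_ne_top _ _)).2 h2), h3⟩
  rw [hset, Real.volume_Ioo, sub_zero, measureReal_def, ENNReal.ofReal_toReal (measure_ne_top _ _)]

theorem map_signedRearr {f : Ω → ℝ} (hf : AEMeasurable f μ) :
    (volume.restrict (Ioo 0 (μ.real univ))).map (signedRearr μ f) = μ.map f := by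
  have hm := aemeasurable_signedRearr hf
  refine ext_of_Ioi ?_ fun a => ?_
  · rw [Measure.map_apply_of_aemeasurable hm MeasurableSet.univ,
      Measure.map_apply_of_aemeasurable hf MeasurableSet.univ]
    simp [measureReal_def, ENNReal.ofReal_toReal (measure_ne_top μ univ)]
  · rw [Measure.map_apply_of_aemeasurable hm measurableSet_Ioi,
      Measure.map_apply_of_aemeasurable hf measurableSet_Ioi,
      Measure.restrict_apply' measurableSet_Ioo]
    exact volume_lt_signedRearr hf a

theorem lintegral_comp_signedRearr {f : Ω → ℝ} (hf : AEMeasurable f μ) {F : ℝ → ℝ≥0∞}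
    (hF : Measurable F) :
    ∫⁻ s in Ioo 0 (μ.real univ), F (signedRearr μ f s) = ∫⁻ x, F (f x) ∂μ := by
  rw [← lintegral_map' hF.aemeasurable (aemeasurable_signedRearr hf), map_signedRearr hf,
    lintegral_map' hF.aemeasurable hf]

theorem integrableOn_signedRearr {f : Ω → ℝ} (hf : Integrable f μ) :
    IntegrableOn (signedRearr μ f) (Ioo 0 (μ.real univ)) := by
  have h1 : Integrable id (μ.map f) :=
    (integrable_map_measure measurable_id.aestronglyMeasurable hf.aemeasurable).2 hf
  rw [← map_signedRearr hf.aemeasurable] at h1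
  exact (integrable_map_measure measurable_id.aestronglyMeasurable
    (aemeasurable_signedRearr hf.aemeasurable)).1 h1

theorem measure_signedRearr_lt_le {f : Ω → ℝ} (hf : AEMeasurable f μ) {s : ℝ}
    (hs : s ∈ Ioo 0 (μ.real univ)) :
    μ {x | signedRearr μ f s < f x} ≤ ENNReal.ofReal s :=
  (signedRearr_le_iff hf hs _).1 le_rfl

theorem decRearr_eq_signedRearr {f : Ω → ℝ} (hf : AEMeasurable f μ) {s : ℝ}
    (hs : s ∈ Ioo 0 (μ.real univ)) :
    decRearr μ f s = signedRearr μ (fun x => |f x|) s := by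
  have habs : AEMeasurable (fun x => |f x|) μ := measurable_norm.comp_aemeasurable hf
  rw [decRearr, signedRearr]
  congr 1
  ext t
  refine ⟨fun h => h.2, fun h => ⟨?_, h⟩⟩
  exact (signedRearr_nonneg habs (fun x => abs_nonneg _) hs).trans
    ((signedRearr_le_iff habs hs t).2 h)

theorem rearrInt_univ {w : Ω → ℝ} (hw : AEMeasurable w μ) :
    rearrInt μ w (μ.real univ) = ∫⁻ x, ENNReal.ofReal (w x) ∂μ :=
  lintegral_comp_signedRearr hw ENNReal.measurable_ofReal

theorem mul_le_rearrInt {w : Ω → ℝ} (hw : AEMeasurable w μ) {t : ℝ}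
    (ht : t ∈ Ioo 0 (μ.real univ)) :
    ENNReal.ofReal t * ENNReal.ofReal (signedRearr μ w t) ≤ rearrInt μ w t := by
  calc ENNReal.ofReal t * ENNReal.ofReal (signedRearr μ w t)
      = ∫⁻ _ in Ioo 0 t, ENNReal.ofReal (signedRearr μ w t) := by
        rw [setLIntegral_const, Real.volume_Ioo, sub_zero, mul_comm]
    _ ≤ _ := setLIntegral_mono' measurableSet_Ioo fun s hs => ENNReal.ofReal_le_ofReal
        (antitoneOn_signedRearr hw ⟨hs.1, hs.2.trans ht.2⟩ ht hs.2.le)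

/-- By monotonicity the integral over `[t, r)` is at most `t` times the value at `t`, hence at most
the integral over `(0, t)`. -/
theorem rearrInt_le_two_mul {w : Ω → ℝ} (hw : AEMeasurable w μ) {t r : ℝ}
    (ht : t ∈ Ioo 0 (μ.real univ)) (hr : r ≤ 2 * t) (hrM : r ≤ μ.real univ) :
    rearrInt μ w r ≤ 2 * rearrInt μ w t := by
  have hsub : Ioo 0 r ⊆ Ioo 0 t ∪ Ico t r := by
    intro s hs
    rcases lt_or_ge s t with h | h
    · exact Or.inl ⟨hs.1, h⟩
    · exact Or.inr ⟨h, hs.2⟩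
  have h2 : ∫⁻ s in Ico t r, ENNReal.ofReal (signedRearr μ w s) ≤ rearrInt μ w t := by
    calc ∫⁻ s in Ico t r, ENNReal.ofReal (signedRearr μ w s)
        ≤ ∫⁻ _ in Ico t r, ENNReal.ofReal (signedRearr μ w t) :=
          setLIntegral_mono' measurableSet_Ico fun s hs => ENNReal.ofReal_le_ofReal
            (antitoneOn_signedRearr hw ht ⟨ht.1.trans_le hs.1, hs.2.trans_le hrM⟩ hs.1)
      _ = ENNReal.ofReal (r - t) * ENNReal.ofReal (signedRearr μ w t) := by
          rw [setLIntegral_const, Real.volume_Ico, mul_comm]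
      _ ≤ ENNReal.ofReal t * ENNReal.ofReal (signedRearr μ w t) := by
          gcongr
          linarith
      _ ≤ _ := mul_le_rearrInt hw ht
  calc rearrInt μ w r ≤ ∫⁻ s in Ioo 0 t ∪ Ico t r, ENNReal.ofReal (signedRearr μ w s) :=
        lintegral_mono_set hsub
    _ ≤ rearrInt μ w t + ∫⁻ s in Ico t r, ENNReal.ofReal (signedRearr μ w s) :=
        lintegral_union_le _ _ _
    _ ≤ rearrInt μ w t + rearrInt μ w t := by gcongr
    _ = _ := (two_mul _).symm

theorem lintegral_sub_signedRearr {w : Ω → ℝ} (hw : AEMeasurable w μ) {t : ℝ}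
    (ht : t ∈ Ioo 0 (μ.real univ)) :
    ∫⁻ x, ENNReal.ofReal (w x - signedRearr μ w t) ∂μ =
      ∫⁻ s in Ioo 0 t, ENNReal.ofReal (signedRearr μ w s - signedRearr μ w t) := by
  rw [← lintegral_comp_signedRearr hw (F := fun y => ENNReal.ofReal (y - signedRearr μ w t))
    (by fun_prop)]
  have h1 : ∀ s ∈ Ioo 0 (μ.real univ), ENNReal.ofReal (signedRearr μ w s - signedRearr μ w t) =
      (Ioo 0 t).indicator
        (fun s => ENNReal.ofReal (signedRearr μ w s - signedRearr μ w t)) s := by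
    intro s hs
    by_cases hst : s ∈ Ioo 0 t
    · rw [indicator_of_mem hst]
    · rw [indicator_of_notMem hst, ENNReal.ofReal_eq_zero, sub_nonpos]
      exact antitoneOn_signedRearr hw ht hs (not_lt.1 fun h => hst ⟨hs.1, h⟩)
  have hsub : Ioo 0 t ∩ Ioo 0 (μ.real univ) = Ioo 0 t :=
    inter_eq_left.2 (Ioo_subset_Ioo_right ht.2.le)
  rw [setLIntegral_congr_fun measurableSet_Ioo h1, setLIntegral_indicator measurableSet_Ioo, hsub]

/-- The Hardy–Littlewood inequality, from w ≤ (w - a)₊ + a with a = w*(r): this choice turns the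
bound into exactly ∫₀ʳ w*. -/
theorem setLIntegral_le_rearrInt {w : Ω → ℝ} (hw : AEMeasurable w μ) (h0 : ∀ x, 0 ≤ w x) {r : ℝ}
    (hr : r ∈ Ioo 0 (μ.real univ)) {B : Set Ω} (hB : μ B ≤ ENNReal.ofReal r) :
    ∫⁻ x in B, ENNReal.ofReal (w x) ∂μ ≤ rearrInt μ w r := by
  set a := signedRearr μ w r
  have ha : 0 ≤ a := signedRearr_nonneg hw h0 hr
  calc ∫⁻ x in B, ENNReal.ofReal (w x) ∂μ
      ≤ ∫⁻ x in B, (ENNReal.ofReal (w x - a) + ENNReal.ofReal a) ∂μ := by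
        refine lintegral_mono fun x => ?_
        refine le_trans (ENNReal.ofReal_le_ofReal ?_) ENNReal.ofReal_add_le
        linarith
    _ = ∫⁻ x in B, ENNReal.ofReal (w x - a) ∂μ + ENNReal.ofReal a * μ B := by
        rw [lintegral_add_right _ measurable_const, setLIntegral_const]
    _ ≤ ∫⁻ x, ENNReal.ofReal (w x - a) ∂μ + ENNReal.ofReal a * ENNReal.ofReal r := by
        exact add_le_add (setLIntegral_le_lintegral _ _) (by gcongr)
    _ = ∫⁻ s in Ioo 0 r, (ENNReal.ofReal (signedRearr μ w s - a) + ENNReal.ofReal a) := by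
        rw [lintegral_add_right _ measurable_const, setLIntegral_const, Real.volume_Ioo, sub_zero,
          lintegral_sub_signedRearr hw hr]
    _ = rearrInt μ w r := by
        refine setLIntegral_congr_fun measurableSet_Ioo fun s hs => ?_
        have h1 : a ≤ signedRearr μ w s :=
          antitoneOn_signedRearr hw ⟨hs.1, hs.2.trans hr.2⟩ hr hs.2.le
        rw [← ENNReal.ofReal_add (by linarith) ha, sub_add_cancel]

theorem lintegral_sub_le_rearrInt {w : Ω → ℝ} (hw : AEMeasurable w μ) (h0 : ∀ x, 0 ≤ w x) {t : ℝ}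
    (ht : t ∈ Ioo 0 (μ.real univ)) :
    ∫⁻ x, ENNReal.ofReal (w x - signedRearr μ w t) ∂μ ≤ rearrInt μ w t := by
  rw [lintegral_sub_signedRearr hw ht]
  refine lintegral_mono fun s => ENNReal.ofReal_le_ofReal ?_
  linarith [signedRearr_nonneg hw h0 ht]

theorem le_measure_signedRearr_le {f : Ω → ℝ} (hf : AEMeasurable f μ) {s : ℝ}
    (hs : s ∈ Ioo 0 (μ.real univ)) :
    ENNReal.ofReal s ≤ μ {x | signedRearr μ f s ≤ f x} := by
  have h1 : μ {x | signedRearr μ f s ≤ f x} = μ.map f (Ici (signedRearr μ f s)) :=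
    (Measure.map_apply_of_aemeasurable hf measurableSet_Ici).symm
  rw [h1, ← map_signedRearr hf,
    Measure.map_apply_of_aemeasurable (aemeasurable_signedRearr hf) measurableSet_Ici,
    Measure.restrict_apply' measurableSet_Ioo]
  calc ENNReal.ofReal s = volume (Ioo 0 s) := by rw [Real.volume_Ioo, sub_zero]
    _ ≤ _ := measure_mono fun r hr => by
        have h2 : r ∈ Ioo 0 (μ.real univ) := ⟨hr.1, hr.2.trans hs.2⟩
        exact ⟨antitoneOn_signedRearr hf h2 hs hr.2.le, h2⟩

end Rearrangement

/-! ### Absence of atoms and transport to Lebesgue measure. -/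

section Nonatomic

variable {Ω : Type*} [MetricSpace Ω] [MeasurableSpace Ω] {μ : Measure Ω}

/-- An infimum over no sets would be `∞`, so finiteness of the profile provides sets of every
measure. -/
theorem exists_measure_eq (hμ : StandardAssumptions μ) {t : ℝ} (ht : t ∈ Icc 0 (μ.real univ)) :
    ∃ A : Set Ω, MeasurableSet A ∧ μ A = ENNReal.ofReal t := by
  have h := hμ.profile_finite t ht
  by_contra! hA
  refine h ?_
  simp only [isoProfileENN, iInf_eq_top]
  exact fun A h1 h2 => absurd h2 (hA A h1)

theorem StandardAssumptions.nontrivial (hμ : StandardAssumptions μ) (hM : 0 < μ.real univ) :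
    Nontrivial Ω := by
  by_contra hn
  rw [not_nontrivial_iff_subsingleton] at hn
  obtain ⟨A, -, hA⟩ := exists_measure_eq hμ (t := μ.real univ / 2) ⟨by linarith, by linarith⟩
  have h : μ.real A = μ.real univ / 2 := by
    rw [measureReal_def, hA, ENNReal.toReal_ofReal (by linarith)]
  rcases A.eq_empty_or_nonempty with h1 | h1
  · rw [h1, measureReal_empty] at h
    linarith
  · rw [Subsingleton.eq_univ_of_nonempty h1] at h
    linarith

/-- The distance to `x` has gradient modulus 1 at `x`, which is not isolated since the space is
connected and nontrivial; but its gradient must vanish almost everywhere on its zero set `{x}`. -/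
theorem StandardAssumptions.measure_singleton [ConnectedSpace Ω] (hμ : StandardAssumptions μ)
    (hM : 0 < μ.real univ) (x : Ω) : μ {x} = 0 := by
  have := hμ.nontrivial hM
  have hL : IsLip fun y => dist y x := ⟨1, LipschitzWith.dist_left x⟩
  have h := hμ.grad_level _ hL 0
  refine measure_mono_null ?_ h
  rintro y rfl
  have h1 : gradModulus (fun z => dist z y) y = 1 := by
    have : (fun z => edist (dist y y) (dist z y) / edist y z) =ᶠ[𝓝[≠] y] fun _ => 1 := by
      filter_upwards [self_mem_nhdsWithin] with z hz
      have h2 : edist (dist y y) (dist z y) = edist y z := by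
        rw [edist_dist, edist_dist, Real.dist_eq, dist_self, zero_sub, abs_neg,
          abs_of_nonneg dist_nonneg, dist_comm]
      rw [h2]
      exact ENNReal.div_self (by simpa using Ne.symm hz) (edist_ne_top _ _)
    rw [gradModulus, limsup_congr this, limsup_const]
  simp [h1]

/-- A finite measure without point masses carried by a separable set is the pull-back of an
atomless measure on the line. -/
theorem exists_measurable_real_noAtoms [BorelSpace Ω]
    (hs : ∃ s : Set Ω, TopologicalSpace.IsSeparable s ∧ μ sᶜ = 0) (hx : ∀ x : Ω, μ {x} = 0) :
    ∃ ψ : Ω → ℝ, Measurable ψ ∧ ∀ c, μ (ψ ⁻¹' {c}) = 0 := by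
  obtain ⟨s, hs, hs0⟩ := hs
  set S := closure s
  have hSm : MeasurableSet S := isClosed_closure.measurableSet
  have hS0 : μ Sᶜ = 0 := measure_mono_null (compl_subset_compl.2 subset_closure) hs0
  have : SecondCountableTopology S := hs.closure.secondCountableTopology
  -- A measurable injection of the separable closed carrier into Cantor space, then into ℝ: each
  -- fibre of its extension meets the carrier in at most one point.
  obtain ⟨e, he, hinj⟩ := MeasurableSpace.measurable_injection_nat_bool_of_countablySeparated S
  have he' := measurableEmbedding_embeddingReal (ℕ → Bool)
  obtain ⟨ψ, hψ, hψe⟩ := (MeasurableEmbedding.subtype_coe hSm).exists_measurable_extend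
    (he'.measurable.comp he) fun _ => ⟨0⟩
  refine ⟨ψ, hψ, fun c => ?_⟩
  have hsub : (ψ ⁻¹' {c} ∩ S).Subsingleton := by
    rintro x ⟨hxc, hxS⟩ y ⟨hyc, hyS⟩
    have h1 := congrFun hψe ⟨x, hxS⟩
    have h2 := congrFun hψe ⟨y, hyS⟩
    simp only [Function.comp_apply, mem_preimage, mem_singleton_iff] at h1 h2 hxc hyc
    have h3 := hinj (he'.injective (h1.symm.trans (hxc.trans (hyc.symm.trans h2))))
    exact congrArg Subtype.val h3
  have hnull : μ (ψ ⁻¹' {c} ∩ S) = 0 := by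
    rcases hsub.eq_empty_or_singleton with h | ⟨x, h⟩
    · rw [h, measure_empty]
    · rw [h, hx x]
  refine measure_mono_null (fun x hx => ?_) (measure_union_null hnull hS0)
  by_cases h : x ∈ S
  · exact Or.inl ⟨hx, h⟩
  · exact Or.inr h

/-- The distribution function of an atomless finite measure takes every intermediate value. -/
theorem exists_measure_Iic_eq {ν : Measure ℝ} [IsFiniteMeasure ν] [NullSingletonClass ν] {y : ℝ}
    (hy : y ∈ Ioo 0 (ν.real univ)) : ∃ c, ν.real (Iic c) = y := by
  have hcont : Continuous fun c => ν.real (Iic c) := by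
    have h1 : Continuous fun c => ∫ _ in (0 : ℝ)..c, (1 : ℝ) ∂ν :=
      (integrable_const (1 : ℝ)).continuous_primitive 0
    have h2 : (fun c => ν.real (Iic c)) =
        fun c => ν.real (Iic 0) + ∫ _ in (0 : ℝ)..c, (1 : ℝ) ∂ν := by
      ext c
      rw [← intervalIntegral.integral_Iic_sub_Iic (integrable_const (1 : ℝ)).integrableOn
        (integrable_const (1 : ℝ)).integrableOn]
      simp
    rw [h2]
    exact continuous_const.add h1
  have hneg : AEMeasurable (fun x : ℝ => -x) ν := measurable_neg.aemeasurable
  obtain ⟨a, ha⟩ := exists_measure_lt_le hneg hy.1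
  obtain ⟨b, hb⟩ := exists_lt_measure_lt (fun x : ℝ => -x) hy
  refine mem_range_of_exists_le_of_exists_ge hcont ⟨-a - 1, ?_⟩ ⟨-b, ?_⟩
  · refine ENNReal.toReal_le_of_le_ofReal hy.1.le ((measure_mono fun x hx => ?_).trans ha)
    simp only [mem_Iic, mem_ofPred_eq] at hx ⊢
    linarith
  · refine (ENNReal.ofReal_le_iff_le_toReal (measure_ne_top _ _)).1
      (hb.le.trans (measure_mono fun x hx => ?_))
    simp only [mem_Iic, mem_ofPred_eq] at hx ⊢
    linarith

/-- A map transporting `μ` to Lebesgue measure on `(0, μ(Ω))`. -/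
theorem exists_uniform {Ω : Type*} [MeasurableSpace Ω] {μ : Measure Ω} [IsFiniteMeasure μ]
    {ψ : Ω → ℝ} (hψ : Measurable ψ)
    (hψ0 : ∀ c, μ (ψ ⁻¹' {c}) = 0) :
    ∃ Φ : Ω → ℝ, Measurable Φ ∧ μ.map Φ = volume.restrict (Ioo 0 (μ.real univ)) := by
  -- The probability integral transform: `ψ` composed with its own distribution function.
  set ν := μ.map ψ with hν
  have hνu : ν.real univ = μ.real univ := by
    rw [measureReal_def, hν, Measure.map_apply hψ MeasurableSet.univ]; rfl
  have : NullSingletonClass ν := ⟨fun c => by rw [hν, Measure.map_apply hψ (measurableSet_singleton c), hψ0]⟩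
  have hFmono : Monotone fun c => ν.real (Iic c) := fun a b h =>
    measureReal_mono (Iic_subset_Iic.2 h)
  have hΦ : Measurable fun x => ν.real (Iic (ψ x)) := hFmono.measurable.comp hψ
  have hIic : ∀ c, ν.real (Iic c) = μ.real (ψ ⁻¹' Iic c) := fun c => by
    rw [measureReal_def, hν, Measure.map_apply hψ measurableSet_Iic]; rfl
  refine ⟨_, hΦ, Measure.ext_of_Iic _ _ fun y => ?_⟩
  rw [Measure.map_apply hΦ measurableSet_Iic, Measure.restrict_apply measurableSet_Iic]
  -- The distribution function need not be injective, so `{ψ ≤ c}` is only squeezed between `{Φ <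
  -- z}` and `{Φ ≤ z}`; letting z decrease to y recovers equality below.
  have key : ∀ z ∈ Ioo 0 (μ.real univ), μ {x | ν.real (Iic (ψ x)) < z} ≤ ENNReal.ofReal z ∧
      ENNReal.ofReal z ≤ μ {x | ν.real (Iic (ψ x)) ≤ z} := by
    intro z hz
    obtain ⟨c, hc⟩ := exists_measure_Iic_eq (ν := ν) (y := z) (by rwa [hνu])
    have hc' : μ (ψ ⁻¹' Iic c) = ENNReal.ofReal z := by
      rw [← hc, hIic, measureReal_def, ENNReal.ofReal_toReal (measure_ne_top _ _)]
    rw [← hc']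
    constructor
    · refine measure_mono fun x hx => ?_
      simp only [mem_ofPred_eq, mem_preimage, mem_Iic] at hx ⊢
      by_contra! h
      exact absurd (hFmono h.le) (not_le.2 (hx.trans_eq hc.symm))
    · refine measure_mono fun x hx => ?_
      exact (hFmono hx).trans hc.le
  rcases le_or_gt (μ.real univ) y with hy | hy
  · have h1 : Iic y ∩ Ioo 0 (μ.real univ) = Ioo 0 (μ.real univ) :=
      inter_eq_right.2 fun z hz => hz.2.le.trans hy
    have h2 : (fun x => ν.real (Iic (ψ x))) ⁻¹' Iic y = univ :=
      eq_univ_of_forall fun x => (measureReal_mono (subset_univ _)).trans (hνu.le.trans hy)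
    rw [h1, h2, Real.volume_Ioo, sub_zero, measureReal_def,
      ENNReal.ofReal_toReal (measure_ne_top _ _)]
  · have h1 : Iic y ∩ Ioo 0 (μ.real univ) = Ioc 0 y := by
      ext z
      simp only [mem_inter_iff, mem_Iic, mem_Ioo, mem_Ioc]
      exact ⟨fun h => ⟨h.2.1, h.1⟩, fun h => ⟨h.2, h.1, h.2.trans_lt hy⟩⟩
    rw [h1, Real.volume_Ioc, sub_zero]
    refine le_antisymm ?_ ?_
    · rcases (measureReal_nonneg (μ := μ) (s := univ)).eq_or_lt with hM | hM
      · have h0 : μ univ = 0 := by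
          rwa [eq_comm, measureReal_def, ENNReal.toReal_eq_zero_iff, or_iff_left
            (measure_ne_top _ _)] at hM
        rw [measure_mono_null (subset_univ _) h0]
        exact zero_le
      have hmax : max 0 y < μ.real univ := max_lt hM hy
      have ht : Tendsto ENNReal.ofReal (𝓝[>] (max 0 y)) (𝓝 (ENNReal.ofReal (max 0 y))) :=
        (ENNReal.continuous_ofReal.tendsto _).mono_left nhdsWithin_le_nhds
      rw [ENNReal.ofReal_max, ENNReal.ofReal_zero,
        max_eq_right (show (0 : ℝ≥0∞) ≤ _ from zero_le)] at ht
      refine ge_of_tendsto ht ?_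
      filter_upwards [Ioo_mem_nhdsGT hmax] with z hz
      refine le_trans (measure_mono fun x hx => ?_)
        (key z ⟨(le_max_left _ _).trans_lt hz.1, hz.2⟩).1
      exact lt_of_le_of_lt (mem_Iic.1 hx) ((le_max_right _ _).trans_lt hz.1)
    · rcases le_or_gt y 0 with h | h
      · rw [ENNReal.ofReal_of_nonpos h]
        exact zero_le
      · exact (key y ⟨h, hy⟩).2

end Nonatomic

/-! ### Hölder's inequality against the fundamental function. -/

section Hoelder

variable {Ω : Type*} [MeasurableSpace Ω] {μ : Measure Ω} {ρ : (Ω → ℝ≥0∞) → ℝ≥0∞}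

theorem IsRINorm.sum_le (hρ : IsRINorm μ ρ) {ι : Type*} (s : Finset ι) (f : ι → Ω → ℝ≥0∞)
    (hf : ∀ i ∈ s, AEMeasurable (f i) μ) :
    ρ (fun x => ∑ i ∈ s, f i x) ≤ ∑ i ∈ s, ρ (f i) := by
  classical
  induction s using Finset.induction_on with
  | empty =>
    simp only [Finset.sum_empty]
    exact ((hρ.eq_zero_iff _ aemeasurable_const).2 (ae_eq_refl _)).le
  | insert a s ha ih =>
    simp only [Finset.sum_insert ha]
    refine (hρ.add_le _ _ (hf a (by simp)) (Finset.aemeasurable_fun_sum _ fun i hi =>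
      hf i (by simp [hi]))).trans ?_
    gcongr
    exact ih fun i hi => hf i (by simp [hi])

theorem measure_indicator_one_gt (A : Set Ω) (t : ℝ≥0∞) :
    μ {x | t < A.indicator (1 : Ω → ℝ≥0∞) x} = if t < 1 then μ A else 0 := by
  split_ifs with h
  · congr 1
    ext x
    by_cases hx : x ∈ A <;> simp [hx, h]
  · have : {x | t < A.indicator (1 : Ω → ℝ≥0∞) x} = ∅ := by
      refine eq_empty_of_forall_notMem fun x hx => ?_
      rw [mem_ofPred_eq] at hx
      exact h (hx.trans_le (indicator_le_self' (fun _ _ => zero_le) x))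
    rw [this, measure_empty]

theorem IsRINorm.fundamentalFunction_eq (hρ : IsRINorm μ ρ) {A : Set Ω} (hA : MeasurableSet A)
    {t : ℝ} (hAt : μ A = ENNReal.ofReal t) : fundamentalFunction μ ρ t = ρ (A.indicator 1) := by
  refine le_antisymm (iInf_le_of_le A (iInf_le_of_le hA (iInf_le_of_le hAt le_rfl))) ?_
  refine le_iInf fun B => le_iInf fun hB => le_iInf fun hBt => le_of_eq ?_
  refine hρ.rearrangement_invariant _ _ (measurable_one.indicator hA).aemeasurable
    (measurable_one.indicator hB).aemeasurable fun s => ?_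
  rw [measure_indicator_one_gt, measure_indicator_one_gt, hAt, hBt]

/-- Averaging a step function over the cyclic permutations of its steps does not increase
the norm. -/
theorem IsRINorm.step_average_le (hρ : IsRINorm μ ρ) {N : ℕ} [NeZero N] {J : Fin N → Set Ω}
    (hJ : ∀ i, MeasurableSet (J i)) (hdisj : Pairwise fun i j => Disjoint (J i) (J j))
    {m : ℝ≥0∞} (hm : ∀ i, μ (J i) = m) (a : Fin N → ℝ≥0) {w : Ω → ℝ≥0∞}
    (hw : AEMeasurable w μ) (haw : ∀ i, ∀ᵐ x ∂μ, x ∈ J i → (a i : ℝ≥0∞) ≤ w x) :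
    (∑ i, a i : ℝ≥0) * ρ ((⋃ i, J i).indicator 1) ≤ N * ρ w := by
  classical
  -- The heights are shifted cyclically by `k`. All these functions are equimeasurable, and their
  -- sum over `k` is constant on the union of the steps.
  set v : Fin N → Ω → ℝ≥0∞ := fun k x => ∑ i, (J i).indicator (fun _ => (a (i + k) : ℝ≥0∞)) x
    with hv
  have hvm : ∀ k, Measurable (v k) := fun k =>
    Finset.measurable_fun_sum _ fun i _ => measurable_const.indicator (hJ i)
  have hv1 : ∀ k i x, x ∈ J i → v k x = a (i + k) := by
    intro k i x hx
    simp only [hv]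
    rw [Finset.sum_eq_single i]
    · rw [indicator_of_mem hx]
    · intro j _ hji
      exact indicator_of_notMem (fun h => (hdisj hji).le_bot ⟨h, hx⟩) _
    · simp
  have hv0 : ∀ k x, x ∉ (⋃ i, J i) → v k x = 0 := by
    intro k x hx
    refine Finset.sum_eq_zero fun i _ => indicator_of_notMem (fun h => hx (mem_iUnion.2 ⟨i, h⟩)) _
  have hdist : ∀ k t, μ {x | t < v k x} = ∑ i, if t < (a (i + k) : ℝ≥0∞) then m else 0 := by
    intro k t
    have hset : {x | t < v k x} = ⋃ i, {x | x ∈ J i ∧ t < (a (i + k) : ℝ≥0∞)} := by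
      ext x
      simp only [mem_ofPred_eq, mem_iUnion]
      constructor
      · intro h
        by_cases hx : x ∈ ⋃ i, J i
        · obtain ⟨i, hi⟩ := mem_iUnion.1 hx
          exact ⟨i, hi, hv1 k i x hi ▸ h⟩
        · rw [hv0 k x hx] at h
          exact absurd h not_lt_zero
      · rintro ⟨i, hi, h⟩
        rwa [hv1 k i x hi]
    have hdec : ∀ i, {x | x ∈ J i ∧ t < (a (i + k) : ℝ≥0∞)} =
        if t < (a (i + k) : ℝ≥0∞) then J i else ∅ := by
      intro i
      split_ifs with h <;> simp [h]
    rw [hset, measure_iUnion, tsum_fintype]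
    · refine Finset.sum_congr rfl fun i _ => ?_
      rw [hdec]
      split_ifs <;> simp [hm]
    · intro i j hij
      exact (hdisj hij).mono (fun x hx => hx.1) (fun x hx => hx.1)
    · intro i
      rw [hdec]
      split_ifs
      exacts [hJ i, MeasurableSet.empty]
  have heq : ∀ k, ρ (v k) = ρ (v 0) := by
    intro k
    refine hρ.rearrangement_invariant _ _ (hvm k).aemeasurable (hvm 0).aemeasurable fun t => ?_
    rw [hdist, hdist]
    simp only [add_zero]
    exact Equiv.sum_comp (Equiv.addRight k) fun i => if t < (a i : ℝ≥0∞) then m else 0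
  have hle : ρ (v 0) ≤ ρ w := by
    refine hρ.mono _ _ (hvm 0).aemeasurable hw ?_
    filter_upwards [ae_all_iff.2 haw] with x hx
    by_cases hxJ : x ∈ ⋃ i, J i
    · obtain ⟨i, hi⟩ := mem_iUnion.1 hxJ
      rw [hv1 0 i x hi, add_zero]
      exact hx i hi
    · rw [hv0 0 x hxJ]
      exact zero_le
  have hsum : (fun x => ((∑ i, a i : ℝ≥0) : ℝ≥0∞) * (⋃ i, J i).indicator (1 : Ω → ℝ≥0∞) x) =
      fun x => ∑ k, v k x := by
    ext x
    by_cases hxJ : x ∈ ⋃ i, J i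
    · obtain ⟨i, hi⟩ := mem_iUnion.1 hxJ
      rw [indicator_of_mem hxJ]
      simp only [hv1 _ i x hi, Pi.one_apply, mul_one, ENNReal.ofNNReal_finsetSum]
      exact (Equiv.sum_comp (Equiv.addLeft i) fun k => (a k : ℝ≥0∞)).symm
    · simp [indicator_of_notMem hxJ, hv0 _ x hxJ]
  calc (∑ i, a i : ℝ≥0) * ρ ((⋃ i, J i).indicator 1)
      = ρ (fun x => ∑ k, v k x) := by
        rw [← hsum, hρ.smul]
        exact (measurable_one.indicator (MeasurableSet.iUnion hJ)).aemeasurable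
    _ ≤ ∑ k, ρ (v k) := hρ.sum_le _ _ fun k _ => (hvm k).aemeasurable
    _ = N * ρ (v 0) := by simp [heq]
    _ ≤ _ := by gcongr

variable [IsFiniteMeasure μ]

/-- An upper sum with left endpoints. The same values are right endpoints one cell earlier, so they
also form a step function below the rearrangement on `(0, t]`. The first cell is left out because
the rearrangement may be unbounded at 0. -/
theorem setLIntegral_signedRearr_le_sum {w : Ω → ℝ} (hw : AEMeasurable w μ) {t : ℝ}
    (ht : t ∈ Ioo 0 (μ.real univ)) {N : ℕ} (hN : 0 < N) :
    ∫⁻ s in Ioo (t / N) t, ENNReal.ofReal (signedRearr μ w s) ≤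
      ENNReal.ofReal (t / N) *
        ∑ i : Fin N, ENNReal.ofReal (signedRearr μ w (((i : ℕ) + 1) * (t / N))) := by
  have hN' : (0 : ℝ) < N := Nat.cast_pos.2 hN
  have hd : 0 < t / N := div_pos ht.1 hN'
  set d := t / N with hd'
  have hNd : N * d = t := mul_div_cancel₀ t hN'.ne'
  have hsub : Ioo d t ⊆
      ⋃ i : Fin N, Ico (((i : ℕ) + 1) * d) (((i : ℕ) + 2) * d) ∩ Ioo 0 (μ.real univ) := by
    intro s hs
    have h0 : 1 ≤ s / d := (one_le_div hd).2 hs.1.le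
    have h1 : 1 ≤ ⌊s / d⌋₊ := Nat.le_floor (by simpa using h0)
    have h2 : ⌊s / d⌋₊ ≤ s / d := Nat.floor_le (by linarith)
    have h3 : s / d < ⌊s / d⌋₊ + 1 := Nat.lt_floor_add_one _
    obtain ⟨k, hk⟩ := Nat.exists_eq_add_of_le' h1
    rw [hk] at h2 h3
    push_cast at h2 h3
    rw [le_div_iff₀ hd] at h2
    rw [div_lt_iff₀ hd] at h3
    have h4 : k < N := by
      have : (k : ℝ) * d < N * d := by linarith [hs.2]
      exact_mod_cast lt_of_mul_lt_mul_right this hd.le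
    exact mem_iUnion.2 ⟨⟨k, h4⟩, ⟨h2, by simp only; linarith⟩, hd.trans hs.1, hs.2.trans ht.2⟩
  calc ∫⁻ s in Ioo d t, ENNReal.ofReal (signedRearr μ w s)
      ≤ _ := lintegral_mono_set hsub
    _ ≤ ∑' i : Fin N, ∫⁻ s in Ico (((i : ℕ) + 1) * d) (((i : ℕ) + 2) * d) ∩ Ioo 0 (μ.real univ),
          ENNReal.ofReal (signedRearr μ w s) := lintegral_iUnion_le _ _
    _ = ∑ i : Fin N, ∫⁻ s in Ico (((i : ℕ) + 1) * d) (((i : ℕ) + 2) * d) ∩ Ioo 0 (μ.real univ),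
          ENNReal.ofReal (signedRearr μ w s) := tsum_fintype _
    _ ≤ ∑ i : Fin N, ENNReal.ofReal d * ENNReal.ofReal (signedRearr μ w (((i : ℕ) + 1) * d)) := by
        refine Finset.sum_le_sum fun i _ => ?_
        have hi : (((i : ℕ) : ℝ) + 1) * d ≤ t := by
          rw [← hNd]
          gcongr
          exact_mod_cast i.2
        calc ∫⁻ s in Ico (((i : ℕ) + 1) * d) (((i : ℕ) + 2) * d) ∩ Ioo 0 (μ.real univ),
              ENNReal.ofReal (signedRearr μ w s)
            ≤ ∫⁻ _ in Ico (((i : ℕ) + 1) * d) (((i : ℕ) + 2) * d) ∩ Ioo 0 (μ.real univ),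
              ENNReal.ofReal (signedRearr μ w (((i : ℕ) + 1) * d)) :=
              setLIntegral_mono' (measurableSet_Ico.inter measurableSet_Ioo) fun s hs =>
                ENNReal.ofReal_le_ofReal (antitoneOn_signedRearr hw
                  ⟨by positivity, hi.trans_lt ht.2⟩ hs.2 hs.1.1)
          _ ≤ _ := by
              rw [setLIntegral_const, mul_comm]
              gcongr
              refine (measure_mono inter_subset_left).trans ?_
              rw [Real.volume_Ico]
              exact ENNReal.ofReal_le_ofReal (by linarith)
    _ = _ := (Finset.mul_sum _ _ _).symm

/-- The maximal average of a nonnegative function is controlled by its norm in every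
rearrangement invariant space. -/
theorem IsRINorm.fundamentalFunction_mul_rearrInt_le (hρ : IsRINorm μ ρ)
    {Φ : Ω → ℝ} (hΦ : Measurable Φ) (hΦμ : μ.map Φ = volume.restrict (Ioo 0 (μ.real univ)))
    {w : Ω → ℝ} (hw : AEMeasurable w μ) {t : ℝ} (ht : t ∈ Ioo 0 (μ.real univ)) :
    fundamentalFunction μ ρ t * rearrInt μ w t ≤
      ENNReal.ofReal t * ρ (fun x => ENNReal.ofReal (w x)) := by
  have hH : AEMeasurable (signedRearr μ w) (μ.map Φ) := hΦμ ▸ aemeasurable_signedRearr hw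
  have hHΦ : AEMeasurable (fun x => signedRearr μ w (Φ x)) μ := hH.comp_measurable hΦ
  have hmap : μ.map (fun x => signedRearr μ w (Φ x)) = μ.map w := by
    rw [← map_signedRearr hw, ← hΦμ, AEMeasurable.map_map_of_aemeasurable hH hΦ.aemeasurable]
    rfl
  -- The rearrangement of `w` pulled back by `Φ` has the distribution of `w`, so it may replace `w`
  -- in the norm.
  have hρw : ρ (fun x => ENNReal.ofReal (signedRearr μ w (Φ x))) =
      ρ (fun x => ENNReal.ofReal (w x)) := by
    refine hρ.rearrangement_invariant _ _ hHΦ.ennreal_ofReal hw.ennreal_ofReal fun u => ?_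
    have hu : MeasurableSet {y : ℝ | u < ENNReal.ofReal y} :=
      measurableSet_lt measurable_const ENNReal.measurable_ofReal
    have h1 := Measure.map_apply_of_aemeasurable hHΦ hu
    rw [hmap, Measure.map_apply_of_aemeasurable hw hu] at h1
    exact h1.symm
  have hN : ∀ N : ℕ, 0 < N → fundamentalFunction μ ρ t *
      ∫⁻ s in Ioo (t / N) t, ENNReal.ofReal (signedRearr μ w s) ≤
        ENNReal.ofReal t * ρ (fun x => ENNReal.ofReal (w x)) := by
    intro N hN
    have : NeZero N := ⟨hN.ne'⟩
    have hN' : (0 : ℝ) < N := Nat.cast_pos.2 hN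
    set d := t / N with hd'
    have hd : 0 < d := div_pos ht.1 hN'
    have hNd : N * d = t := mul_div_cancel₀ t hN'.ne'
    set J : Fin N → Set Ω := fun i => Φ ⁻¹' Ioc ((i : ℕ) * d) (((i : ℕ) + 1) * d) with hJ
    have hi : ∀ i : Fin N, (((i : ℕ) : ℝ) + 1) * d ≤ t := fun i => by
      rw [← hNd]
      gcongr
      exact_mod_cast i.2
    have hJm : ∀ i, MeasurableSet (J i) := fun i => hΦ measurableSet_Ioc
    have hJμ : ∀ i, μ (J i) = ENNReal.ofReal d := by
      intro i
      rw [hJ, ← Measure.map_apply hΦ measurableSet_Ioc, hΦμ,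
        Measure.restrict_apply measurableSet_Ioc, inter_eq_left.2, Real.volume_Ioc]
      · congr 1
        ring
      · exact fun s hs => ⟨lt_of_le_of_lt (by positivity) hs.1,
          hs.2.trans_lt ((hi i).trans_lt ht.2)⟩
    have hdisj : Pairwise fun i j => Disjoint (J i) (J j) := by
      have : ∀ i j : Fin N, i < j → Disjoint (J i) (J j) := by
        intro i j hij
        refine Disjoint.preimage _ (Set.disjoint_left.2 fun s hs hs' => ?_)
        have h1 : (((i : ℕ) : ℝ) + 1) * d ≤ (j : ℕ) * d := by
          gcongr
          exact_mod_cast hij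
        linarith [hs.2, hs'.1]
      intro i j hij
      rcases lt_or_gt_of_ne hij with h | h
      exacts [this i j h, (this j i h).symm]
    have hUμ : μ (⋃ i, J i) = ENNReal.ofReal t := by
      rw [measure_iUnion hdisj hJm, tsum_fintype]
      simp only [hJμ, Finset.sum_const, Finset.card_univ, Fintype.card_fin, nsmul_eq_mul]
      rw [← hNd, ENNReal.ofReal_mul hN'.le, ENNReal.ofReal_natCast]
    have hstep := hρ.step_average_le hJm hdisj hJμ
      (fun i => (signedRearr μ w (((i : ℕ) + 1) * d)).toNNReal) hHΦ.ennreal_ofReal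
      (fun i => Eventually.of_forall fun x hx => ENNReal.ofReal_le_ofReal
        (antitoneOn_signedRearr hw ⟨lt_of_le_of_lt (by positivity) hx.1,
          hx.2.trans_lt ((hi i).trans_lt ht.2)⟩ ⟨by positivity, (hi i).trans_lt ht.2⟩ hx.2))
    rw [hρw, ← hρ.fundamentalFunction_eq (MeasurableSet.iUnion hJm) hUμ,
      ENNReal.ofNNReal_finsetSum] at hstep
    calc fundamentalFunction μ ρ t * ∫⁻ s in Ioo d t, ENNReal.ofReal (signedRearr μ w s)
        ≤ fundamentalFunction μ ρ t * (ENNReal.ofReal d *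
          ∑ i : Fin N, ENNReal.ofReal (signedRearr μ w (((i : ℕ) + 1) * d))) := by
          gcongr
          exact setLIntegral_signedRearr_le_sum hw ht hN
      _ = ENNReal.ofReal d * ((∑ i : Fin N, ENNReal.ofReal
            (signedRearr μ w (((i : ℕ) + 1) * d))) * fundamentalFunction μ ρ t) := by ring
      _ ≤ ENNReal.ofReal d * (N * ρ (fun x => ENNReal.ofReal (w x))) := by
          exact mul_le_mul' le_rfl hstep
      _ = _ := by
          rw [← mul_assoc, ← ENNReal.ofReal_natCast, ← ENNReal.ofReal_mul hd.le, mul_comm d, hNd]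
  have hU : Ioo 0 t = ⋃ n : ℕ, Ioo (t / ((n + 1 : ℕ) : ℝ)) t := by
    ext s
    simp only [mem_Ioo, mem_iUnion]
    constructor
    · intro hs
      obtain ⟨n, hn⟩ := exists_nat_gt (t / s)
      refine ⟨n, ?_, hs.2⟩
      rw [div_lt_iff₀ (by positivity)]
      rw [div_lt_iff₀ hs.1] at hn
      push_cast
      nlinarith [hs.1]
    · rintro ⟨n, hn, hs⟩
      exact ⟨lt_of_le_of_lt (div_nonneg ht.1.le (by positivity)) hn, hs⟩
  have hmono : Monotone fun n : ℕ => Ioo (t / ((n + 1 : ℕ) : ℝ)) t := by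
    intro m n hmn
    refine Ioo_subset_Ioo_left ?_
    have := ht.1
    gcongr
  -- Monotone convergence as N → ∞ restores the omitted cell.
  rw [rearrInt, hU, setLIntegral_iUnion_of_directed _ hmono.directed_le, ENNReal.mul_iSup]
  exact iSup_le fun n => hN (n + 1) n.succ_pos

end Hoelder

/-! ### Oscillation of rearrangements, and integrability. -/

section Oscillation

variable {Ω : Type*} [MeasurableSpace Ω] {μ : Measure Ω} [IsFiniteMeasure μ]

theorem ofReal_mul_signedRearrAvg_sub {f : Ω → ℝ} (hf : Integrable f μ) {t : ℝ}
    (ht : t ∈ Ioo 0 (μ.real univ)) :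
    ENNReal.ofReal t * ENNReal.ofReal (signedRearrAvg μ f t - signedRearr μ f t) =
      ∫⁻ s in Ioo 0 t, ENNReal.ofReal (signedRearr μ f s - signedRearr μ f t) := by
  have hint : IntegrableOn (signedRearr μ f) (Ioo 0 t) :=
    (integrableOn_signedRearr hf).mono_set (Ioo_subset_Ioo_right ht.2.le)
  have hconst : IntegrableOn (fun _ : ℝ => signedRearr μ f t) (Ioo 0 t) :=
    integrableOn_const (by simp)
  have h1 : t * (signedRearrAvg μ f t - signedRearr μ f t) =
      ∫ s in Ioo 0 t, (signedRearr μ f s - signedRearr μ f t) := by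
    rw [integral_sub hint hconst, setIntegral_const, signedRearrAvg,
      intervalIntegral.integral_of_le ht.1.le, integral_Ioc_eq_integral_Ioo, mul_sub, ← mul_assoc,
      mul_one_div_cancel ht.1.ne', one_mul]
    simp [measureReal_def, ht.1.le]
  rw [← ENNReal.ofReal_mul ht.1.le, h1]
  refine ofReal_integral_eq_lintegral_ofReal (hint.sub hconst) ?_
  filter_upwards [ae_restrict_mem measurableSet_Ioo] with s hs
  exact sub_nonneg.2 (antitoneOn_signedRearr hf.aemeasurable ⟨hs.1, hs.2.trans ht.2⟩ ht hs.2.le)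

theorem decRearrAvg_eq_signedRearrAvg {f : Ω → ℝ} (hf : AEMeasurable f μ) {t : ℝ}
    (ht : t ∈ Ioo 0 (μ.real univ)) :
    decRearrAvg μ f t = signedRearrAvg μ (fun x => |f x|) t := by
  rw [decRearrAvg, signedRearrAvg, intervalIntegral.integral_of_le ht.1.le,
    intervalIntegral.integral_of_le ht.1.le]
  congr 1
  exact setIntegral_congr_fun measurableSet_Ioc fun s hs =>
    decRearr_eq_signedRearr hf ⟨hs.1, hs.2.trans_lt ht.2⟩

/-- For y < g^s(r) - w^s(s), the set `{g ≥ g^s(r)}` of measure at least `r` is covered by `{f > y}`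
and `{w > w^s(s)}`; if the former had measure at most `t`, then r ≤ s + t. -/
theorem sub_le_signedRearr {f g w : Ω → ℝ} (hf : AEMeasurable f μ) (hg : AEMeasurable g μ)
    (hw : AEMeasurable w μ) (hfg : ∀ x, |f x - g x| ≤ w x) {s r t : ℝ}
    (hs : s ∈ Ioo 0 (μ.real univ)) (hr : r ∈ Ioo 0 (μ.real univ)) (ht : t ∈ Ioo 0 (μ.real univ))
    (hst : s + t < r) :
    signedRearr μ g r - signedRearr μ w s ≤ signedRearr μ f t := by
  refine le_of_forall_lt fun y hy => ?_
  rw [lt_signedRearr_iff hf ht]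
  by_contra! h
  have hsub : {x | signedRearr μ g r ≤ g x} ⊆ {x | y < f x} ∪ {x | signedRearr μ w s < w x} := by
    intro x hx
    by_contra hn
    simp only [mem_union, mem_ofPred_eq, not_or, not_lt] at hn hx
    have := (abs_le.1 (hfg x)).1
    linarith [hn.1, hn.2]
  have h1 := (le_measure_signedRearr_le hg hr).trans ((measure_mono hsub).trans
    ((measure_union_le _ _).trans (add_le_add h (measure_signedRearr_lt_le hw hs))))
  rw [← ENNReal.ofReal_add ht.1.le hs.1.le,
    ENNReal.ofReal_le_ofReal_iff (add_nonneg ht.1.le hs.1.le)] at h1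
  linarith

theorem IsRINorm.integrable_of_lt_top {ρ : (Ω → ℝ≥0∞) → ℝ≥0∞} (hρ : IsRINorm μ ρ)
    {h : Ω → ℝ} (hm : AEMeasurable h μ) (hh : ρ (fun x => ‖h x‖ₑ) < ∞) : Integrable h μ := by
  obtain ⟨C, hC⟩ := hρ.lintegral_le univ MeasurableSet.univ (measure_lt_top _ _)
  have h1 := hC _ hm.enorm
  rw [Measure.restrict_univ] at h1
  exact ⟨hm.aestronglyMeasurable, h1.trans_lt (ENNReal.mul_lt_top ENNReal.coe_lt_top hh)⟩

end Oscillation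

/-! ### Finite gradient integrals and nondegenerate fundamental functions. -/

section Finite

variable {Ω : Type*} [MetricSpace Ω] [MeasurableSpace Ω] {μ : Measure Ω} [IsFiniteMeasure μ]

theorem IsLip.lintegral_gradModulus_lt_top {g : Ω → ℝ} (hg : IsLip g) :
    ∫⁻ x, gradModulus g x ∂μ < ∞ := by
  obtain ⟨L, hL⟩ := hg
  refine (lintegral_mono (gradModulus_le hL)).trans_lt ?_
  simp [ENNReal.mul_lt_top_iff, measure_lt_top]

theorem IsRINorm.fundamentalFunction_ne_zero_and_ne_top (hμ : StandardAssumptions μ)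
    {ρ : (Ω → ℝ≥0∞) → ℝ≥0∞} (hρ : IsRINorm μ ρ) {t : ℝ} (ht : t ∈ Ioo 0 (μ.real univ)) :
    fundamentalFunction μ ρ t ≠ 0 ∧ fundamentalFunction μ ρ t ≠ ∞ := by
  obtain ⟨A, hA, hAt⟩ := exists_measure_eq hμ (Ioo_subset_Icc_self ht)
  rw [hρ.fundamentalFunction_eq hA hAt]
  refine ⟨fun h => ?_, (hρ.indicator_lt_top A hA (measure_lt_top _ _)).ne⟩
  rw [hρ.eq_zero_iff _ (measurable_one.indicator hA).aemeasurable,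
    indicator_ae_eq_zero] at h
  simp only [Function.support_one, inter_univ, hAt, ENNReal.ofReal_eq_zero] at h
  exact absurd ht.1 (not_lt.2 h)

end Finite

/-! ### The oscillation estimate, the Poincaré inequality and the K-functional. -/

section Main

variable {Ω : Type*} [MetricSpace Ω] [MeasurableSpace Ω] [BorelSpace Ω] {μ : Measure Ω}
  [IsFiniteMeasure μ]

/-- The oscillation of `f` in terms of a decomposition `f = (f - g) + g`. -/
theorem StandardAssumptions.oscillation_le (hμ : StandardAssumptions μ)
    (hI : ∀ t ∈ Ioo 0 (μ.real univ), 0 < isoProfile μ t) {f g w D : Ω → ℝ}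
    (hf : Integrable f μ) (hg : IsLip g) (hw : AEMeasurable w μ) (hfg : ∀ x, |f x - g x| ≤ w x)
    (hD : AEMeasurable D μ) (hD0 : ∀ x, 0 ≤ D x) (hgD : ∀ x, gradModulus g x ≤ ENNReal.ofReal (D x))
    {t : ℝ} (ht : t ∈ Ioo 0 (μ.real univ / 2)) :
    ENNReal.ofReal t * ENNReal.ofReal (signedRearrAvg μ f t - signedRearr μ f t) ≤
      9 * rearrInt μ w t + 6 * (ENNReal.ofReal (t / isoProfile μ t) * rearrInt μ D t) := by
  obtain ⟨ht0, ht2⟩ := ht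
  have htM : t ∈ Ioo 0 (μ.real univ) := ⟨ht0, by linarith⟩
  have ht4 : t / 4 ∈ Ioo 0 (μ.real univ) := ⟨by linarith, by linarith⟩
  have hr : 3 / 2 * t ∈ Ioo 0 (μ.real univ) := ⟨by linarith, by linarith⟩
  set r := 3 / 2 * t with hrt
  have hgm : Measurable g := hg.continuous.measurable
  set a := signedRearr μ w (t / 4) with ha
  set b := signedRearr μ g r with hb
  have hw0 : ∀ x, 0 ≤ w x := fun x => (abs_nonneg _).trans (hfg x)
  have ha0 : 0 ≤ a := signedRearr_nonneg hw hw0 ht4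
  have hba : b - a ≤ signedRearr μ f t :=
    sub_le_signedRearr hf.aemeasurable hgm.aemeasurable hw hfg ht4 hr htM (by linarith)
  have hgb : ∫⁻ x, ENNReal.ofReal (g x - b) ∂μ ≤
      6 * (ENNReal.ofReal (t / isoProfile μ t) * rearrInt μ D t) := by
    have hIt := hI t htM
    have hIr := hI r hr
    have hI2 : isoProfile μ t ≤ 2 * isoProfile μ r := hμ.isoProfile_le_two_mul ⟨ht0, ht2⟩
    have h1 := hμ.lintegral_sub_le hg hr.1 hr.2.le (measure_signedRearr_lt_le hgm.aemeasurable hr)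
    have h2 : ∫⁻ x in {x | b < g x}, gradModulus g x ∂μ ≤ 2 * rearrInt μ D t :=
      (lintegral_mono hgD).trans ((setLIntegral_le_rearrInt hD hD0 hr
        (measure_signedRearr_lt_le hgm.aemeasurable hr)).trans
        (rearrInt_le_two_mul hD htM (by linarith) hr.2.le))
    have h3 : r / isoProfile μ r ≤ 3 * (t / isoProfile μ t) := by
      rw [← mul_div_assoc, div_le_div_iff₀ hIr hIt]
      nlinarith
    calc ∫⁻ x, ENNReal.ofReal (g x - b) ∂μ
        = ENNReal.ofReal (r / isoProfile μ r) * (ENNReal.ofReal (isoProfile μ r / r) *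
            ∫⁻ x, ENNReal.ofReal (g x - b) ∂μ) := by
          rw [← mul_assoc, ← ENNReal.ofReal_mul (div_nonneg hr.1.le hIr.le),
            div_mul_div_cancel₀ hIr.ne', div_self hr.1.ne', ENNReal.ofReal_one, one_mul]
      _ ≤ ENNReal.ofReal (3 * (t / isoProfile μ t)) * (2 * rearrInt μ D t) :=
          mul_le_mul' (ENNReal.ofReal_le_ofReal h3) (h1.trans h2)
      _ = _ := by
          rw [ENNReal.ofReal_mul (by norm_num), ENNReal.ofReal_ofNat]
          ring
  have hwa : ∫⁻ x, ENNReal.ofReal (w x - a) ∂μ ≤ rearrInt μ w t :=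
    (lintegral_sub_le_rearrInt hw hw0 ht4).trans (rearrInt_mono w (by linarith))
  -- Since a = w*(t/4), 2at = 8(t/4)a ≤ 8∫₀ᵗ w*; one further copy from (w - a)₊ makes the 9.
  have h2a : ENNReal.ofReal (2 * a) * ENNReal.ofReal t ≤ 8 * rearrInt μ w t := by
    calc ENNReal.ofReal (2 * a) * ENNReal.ofReal t
        = 8 * (ENNReal.ofReal (t / 4) * ENNReal.ofReal a) := by
          rw [← ENNReal.ofReal_mul (by linarith), ← ENNReal.ofReal_mul ht4.1.le,
            ← ENNReal.ofReal_ofNat 8, ← ENNReal.ofReal_mul (by norm_num)]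
          congr 1
          ring
      _ ≤ _ := by
          gcongr
          exact (mul_le_rearrInt hw ht4).trans (rearrInt_mono w (by linarith))
  rw [ofReal_mul_signedRearrAvg_sub hf htM]
  calc ∫⁻ s in Ioo 0 t, ENNReal.ofReal (signedRearr μ f s - signedRearr μ f t)
      ≤ ∫⁻ s in Ioo 0 t,
          (ENNReal.ofReal (signedRearr μ f s - (b + a)) + ENNReal.ofReal (2 * a)) := by
        -- Here f^s(t) ≥ b - a = (b + a) - 2a is used.
        refine lintegral_mono fun s => le_trans (ENNReal.ofReal_le_ofReal ?_)
          ENNReal.ofReal_add_le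
        linarith
    _ = (∫⁻ s in Ioo 0 t, ENNReal.ofReal (signedRearr μ f s - (b + a))) +
          ENNReal.ofReal (2 * a) * ENNReal.ofReal t := by
        rw [lintegral_add_right _ measurable_const, setLIntegral_const, Real.volume_Ioo, sub_zero]
    _ ≤ (∫⁻ s in Ioo 0 (μ.real univ), ENNReal.ofReal (signedRearr μ f s - (b + a))) +
          8 * rearrInt μ w t :=
        add_le_add (lintegral_mono_set (Ioo_subset_Ioo_right htM.2.le)) h2a
    _ = (∫⁻ x, ENNReal.ofReal (f x - (b + a)) ∂μ) + 8 * rearrInt μ w t := by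
        rw [lintegral_comp_signedRearr hf.aemeasurable
          (F := fun y => ENNReal.ofReal (y - (b + a))) (by fun_prop)]
    _ ≤ (∫⁻ x, (ENNReal.ofReal (w x - a) + ENNReal.ofReal (g x - b)) ∂μ) + 8 * rearrInt μ w t := by
        gcongr with x
        refine le_trans (ENNReal.ofReal_le_ofReal ?_) ENNReal.ofReal_add_le
        linarith [(abs_le.1 (hfg x)).2]
    _ = (∫⁻ x, ENNReal.ofReal (w x - a) ∂μ) + (∫⁻ x, ENNReal.ofReal (g x - b) ∂μ) +
          8 * rearrInt μ w t := by
        rw [lintegral_add_right _ (by fun_prop)]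
    _ ≤ rearrInt μ w t + 6 * (ENNReal.ofReal (t / isoProfile μ t) * rearrInt μ D t) +
          8 * rearrInt μ w t := by gcongr
    _ = _ := by ring

/-- The Poincaré inequality with the median. -/
theorem StandardAssumptions.lintegral_sub_median_le (hμ : StandardAssumptions μ)
    (hM : 0 < μ.real univ) {g : Ω → ℝ} (hg : IsLip g) :
    ENNReal.ofReal (isoProfile μ (μ.real univ / 2) / (μ.real univ / 2)) *
      ∫⁻ x, ENNReal.ofReal |g x - signedRearr μ g (μ.real univ / 2)| ∂μ ≤
        ∫⁻ x, gradModulus g x ∂μ := by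
  have hgm : Measurable g := hg.continuous.measurable
  have hr : μ.real univ / 2 ∈ Ioo 0 (μ.real univ) := ⟨by linarith, by linarith⟩
  set r := μ.real univ / 2 with hr'
  set b := signedRearr μ g r with hb
  have h1 := hμ.lintegral_sub_le hg hr.1 hr.2.le (measure_signedRearr_lt_le hgm.aemeasurable hr)
  have hneg : LipschitzWith 1 fun y : ℝ => -y := LipschitzWith.id.neg
  have hset : MeasurableSet {x | g x < b} := measurableSet_lt hgm measurable_const
  have hset' : {x | -b < -g x} = {x | g x < b} := by
    ext x
    simp
  have hbelow : μ {x | g x < b} ≤ ENNReal.ofReal r := by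
    have h2 := le_measure_signedRearr_le hgm.aemeasurable hr
    have h3 : {x | g x < b} = {x | b ≤ g x}ᶜ := by
      ext x
      simp
    rw [h3, measure_compl (measurableSet_le measurable_const hgm) (measure_ne_top _ _)]
    refine (tsub_le_tsub_left h2 _).trans (le_of_eq ?_)
    rw [← ENNReal.ofReal_toReal (measure_ne_top μ univ), ← ENNReal.ofReal_sub _ hr.1.le]
    congr 1
    change μ.real univ - μ.real univ / 2 = μ.real univ / 2
    ring
  -- The part below the median is the part of `-g` above `-b`; both sides have measure at most M/2.
  have h2 := hμ.lintegral_sub_le (hg.comp hneg) (b := -b) hr.1 hr.2.le (by rwa [hset'])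
  rw [hset'] at h2
  have h3 : ∫⁻ x in {x | g x < b}, gradModulus (fun y => -g y) x ∂μ ≤
      ∫⁻ x in {x | g x < b}, gradModulus g x ∂μ :=
    lintegral_mono fun x => gradModulus_comp_le hneg g x
  have habs : ∀ x, ENNReal.ofReal |g x - b| =
      ENNReal.ofReal (g x - b) + ENNReal.ofReal (-g x - -b) := by
    intro x
    rcases le_total b (g x) with h | h
    · rw [abs_of_nonneg (by linarith), ENNReal.ofReal_of_nonpos (p := -g x - -b) (by linarith),
        add_zero]
    · rw [abs_of_nonpos (by linarith), ENNReal.ofReal_of_nonpos (p := g x - b) (by linarith),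
        zero_add]
      congr 1
      ring
  have hdisj : Disjoint {x | b < g x} {x | g x < b} :=
    Set.disjoint_left.2 fun x (hx : b < g x) (hx' : g x < b) => lt_asymm hx hx'
  calc _ = ENNReal.ofReal (isoProfile μ r / r) * ∫⁻ x, ENNReal.ofReal (g x - b) ∂μ +
        ENNReal.ofReal (isoProfile μ r / r) * ∫⁻ x, ENNReal.ofReal (-g x - -b) ∂μ := by
        simp_rw [habs]
        rw [lintegral_add_right _ (by fun_prop), mul_add]
    _ ≤ ∫⁻ x in {x | b < g x}, gradModulus g x ∂μ + ∫⁻ x in {x | g x < b}, gradModulus g x ∂μ :=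
        add_le_add h1 (h2.trans h3)
    _ = ∫⁻ x in {x | b < g x} ∪ {x | g x < b}, gradModulus g x ∂μ :=
        (lintegral_union hset hdisj).symm
    _ ≤ _ := setLIntegral_le_lintegral _ _

/-- The space may be unbounded, so integrability comes from the Poincaré inequality: the gradient is
bounded and the measure finite. -/
theorem StandardAssumptions.integrable_of_isLip (hμ : StandardAssumptions μ)
    (hI : ∀ t ∈ Ioo 0 (μ.real univ), 0 < isoProfile μ t) {g : Ω → ℝ} (hg : IsLip g) :
    Integrable g μ := by
  rcases (measureReal_nonneg (μ := μ) (s := univ)).eq_or_lt with hM | hM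
  · have h0 : μ = 0 := by
      rwa [eq_comm, measureReal_def, ENNReal.toReal_eq_zero_iff, or_iff_left
        (measure_ne_top _ _), Measure.measure_univ_eq_zero] at hM
    rw [h0]
    exact integrable_zero_measure
  have hI2 := hI (μ.real univ / 2) ⟨by linarith, by linarith⟩
  have h1 := (hμ.lintegral_sub_median_le hM hg).trans_lt hg.lintegral_gradModulus_lt_top
  set b := signedRearr μ g (μ.real univ / 2)
  have h2 : ∫⁻ x, ENNReal.ofReal |g x - b| ∂μ < ∞ := by
    rcases ENNReal.mul_lt_top_iff.1 h1 with h | h | h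
    · exact h.2
    · exact absurd (ENNReal.ofReal_eq_zero.1 h) (not_le.2 (div_pos hI2 (by linarith)))
    · rw [h]
      exact ENNReal.zero_lt_top
  have h3 : Integrable (fun x => g x - b) μ := by
    refine ⟨(hg.continuous.measurable.sub_const b).aestronglyMeasurable, ?_⟩
    simpa [HasFiniteIntegral, Real.enorm_eq_ofReal_abs] using h2
  refine (h3.add (integrable_const b)).congr (Eventually.of_forall fun x => ?_)
  simp

theorem StandardAssumptions.integrable_of_memXAddS (hμ : StandardAssumptions μ)
    (hI : ∀ t ∈ Ioo 0 (μ.real univ), 0 < isoProfile μ t) {ρ : (Ω → ℝ≥0∞) → ℝ≥0∞}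
    (hρ : IsRINorm μ ρ) {f : Ω → ℝ} (hf : MemXAddS μ ρ f) : Integrable f μ := by
  obtain ⟨hfm, g, hg, hfg⟩ := hf
  have h1 := hρ.integrable_of_lt_top (h := fun x => f x - g x)
    (hfm.sub hg.1.continuous.measurable.aemeasurable) hfg
  refine (h1.add (hμ.integrable_of_isLip hI hg.1)).congr (Eventually.of_forall fun x => ?_)
  simp

/-- Bounds by maximal averages for all decompositions give bounds by the `K`-functional. -/
theorem StandardAssumptions.le_KFunctional_div [ConnectedSpace Ω] (hμ : StandardAssumptions μ)
    {ρ : (Ω → ℝ≥0∞) → ℝ≥0∞} (hρ : IsRINorm μ ρ) {f : Ω → ℝ} (hf : AEMeasurable f μ) {t τ : ℝ}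
    (ht : t ∈ Ioo 0 (μ.real univ)) {X : ℝ≥0∞}
    (hX : ∀ g, MemS ρ g → ENNReal.ofReal t * X ≤ 16 * (rearrInt μ (fun x => |f x - g x|) t +
      ENNReal.ofReal τ * rearrInt μ (fun x => (gradModulus g x).toReal) t)) :
    X ≤ 16 * (KFunctional ρ τ f / fundamentalFunction μ ρ t) := by
  obtain ⟨hφ0, hφt⟩ := hρ.fundamentalFunction_ne_zero_and_ne_top hμ ht
  obtain ⟨ψ, hψ, hψ0⟩ := exists_measurable_real_noAtoms hμ.separable
    (hμ.measure_singleton (ht.1.trans ht.2))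
  obtain ⟨Φ, hΦ, hΦμ⟩ := exists_uniform hψ hψ0
  rw [← mul_div_assoc, ENNReal.le_div_iff_mul_le (Or.inl hφ0) (Or.inl hφt)]
  refine (ENNReal.div_le_iff_le_mul (b := 16) (by simp) (by simp)).1 ?_ |>.trans_eq (mul_comm _ _)
  refine le_iInf₂ fun g hg => ENNReal.div_le_of_le_mul ?_
  have hgm := hg.1.continuous
  have h1 := hρ.fundamentalFunction_mul_rearrInt_le hΦ hΦμ (w := fun x => |f x - g x|)
    (measurable_norm.comp_aemeasurable (hf.sub hgm.measurable.aemeasurable)) ht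
  have h2 := hρ.fundamentalFunction_mul_rearrInt_le hΦ hΦμ
    (w := fun x => (gradModulus g x).toReal) (measurable_gradModulus hgm).ennreal_toReal.aemeasurable
    ht
  simp only [← Real.enorm_eq_ofReal_abs,
    ENNReal.ofReal_toReal (gradModulus_lt_top hg.1 _).ne] at h1 h2
  have ht0 : ENNReal.ofReal t ≠ 0 := (ENNReal.ofReal_pos.2 ht.1).ne'
  rw [← ENNReal.mul_le_mul_iff_right ht0 ENNReal.ofReal_ne_top]
  set φ := fundamentalFunction μ ρ t
  set R := rearrInt μ (fun x => |f x - g x|) t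
  set R' := rearrInt μ (fun x => (gradModulus g x).toReal) t
  -- The factor φ is absorbed by Hölder's inequality for `f - g` and for the gradient of `g`
  -- separately.
  calc ENNReal.ofReal t * (X * φ) = φ * (ENNReal.ofReal t * X) := by ring
    _ ≤ φ * (16 * (R + ENNReal.ofReal τ * R')) := mul_le_mul' le_rfl (hX g hg)
    _ = 16 * (φ * R + ENNReal.ofReal τ * (φ * R')) := by ring
    _ ≤ 16 * (ENNReal.ofReal t * ρ (fun x => ‖f x - g x‖ₑ) +
          ENNReal.ofReal τ * (ENNReal.ofReal t * ρ (fun x => gradModulus g x))) := by gcongr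
    _ = _ := by ring

end Main

/-! ### The two inequalities of (i). -/

section Direct

variable {Ω : Type*} [MetricSpace Ω] [MeasurableSpace Ω] [BorelSpace Ω]
  {μ : Measure Ω}

theorem aemeasurable_toReal_gradModulus {g : Ω → ℝ} (hg : IsLip g) :
    AEMeasurable (fun x => (gradModulus g x).toReal) μ :=
  (measurable_gradModulus hg.continuous).ennreal_toReal.aemeasurable

variable [IsFiniteMeasure μ]

/-- The mean oscillation of `f` in terms of a decomposition `f = (f - g) + g`. -/
theorem StandardAssumptions.lintegral_sub_mean_le (hμ : StandardAssumptions μ)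
    (hI : ∀ t ∈ Ioo 0 (μ.real univ), 0 < isoProfile μ t) {f g : Ω → ℝ}
    (hf : Integrable f μ) (hg : IsLip g) {t : ℝ} (ht : t ∈ Ioo 0 (μ.real univ))
    (ht2 : μ.real univ / 2 ≤ t) :
    ∫⁻ x, ENNReal.ofReal |f x - (∫ y, f y ∂μ) / μ.real univ| ∂μ ≤
      4 * (rearrInt μ (fun x => |f x - g x|) t + ENNReal.ofReal (t / isoProfile μ t) *
        rearrInt μ (fun x => (gradModulus g x).toReal) t) := by
  have hM : 0 < μ.real univ := ht.1.trans ht.2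
  have hgi := hμ.integrable_of_isLip hI hg
  have hgm := hg.continuous.measurable
  set M := μ.real univ with hMdef
  set b := signedRearr μ g (M / 2) with hb
  set m := (∫ y, f y ∂μ) / M with hm
  set R := rearrInt μ (fun x => |f x - g x|) t
  set R' := rearrInt μ (fun x => (gradModulus g x).toReal) t
  have hfb : Integrable (fun x => f x - b) μ := hf.sub (integrable_const b)
  -- Replacing the mean of `f` by the median of `g` costs only a factor 2.
  have hmb : ENNReal.ofReal |b - m| * μ univ ≤ ∫⁻ x, ENNReal.ofReal |f x - b| ∂μ := by
    have h1 : |b - m| * M ≤ ∫ x, |f x - b| ∂μ := by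
      have h2 : (b - m) * M = -∫ x, (f x - b) ∂μ := by
        rw [integral_sub hf (integrable_const b), integral_const, smul_eq_mul, ← hMdef, sub_mul, hm,
          div_mul_cancel₀ _ hM.ne']
        ring
      calc |b - m| * M = |∫ x, (f x - b) ∂μ| := by
            rw [← abs_neg (∫ x, (f x - b) ∂μ), ← h2, abs_mul, abs_of_pos hM]
        _ ≤ _ := abs_integral_le_integral_abs
    calc ENNReal.ofReal |b - m| * μ univ = ENNReal.ofReal (|b - m| * M) := by
          rw [ENNReal.ofReal_mul (abs_nonneg _), hMdef, measureReal_def,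
            ENNReal.ofReal_toReal (measure_ne_top _ _)]
      _ ≤ ENNReal.ofReal (∫ x, |f x - b| ∂μ) := ENNReal.ofReal_le_ofReal h1
      _ = _ := ofReal_integral_eq_lintegral_ofReal hfb.abs
          (Eventually.of_forall fun x => abs_nonneg _)
  have hfbm : ∫⁻ x, ENNReal.ofReal |f x - m| ∂μ ≤ 2 * ∫⁻ x, ENNReal.ofReal |f x - b| ∂μ := by
    calc ∫⁻ x, ENNReal.ofReal |f x - m| ∂μ
        ≤ ∫⁻ x, (ENNReal.ofReal |f x - b| + ENNReal.ofReal |b - m|) ∂μ := by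
          refine lintegral_mono fun x => le_trans (ENNReal.ofReal_le_ofReal ?_)
            ENNReal.ofReal_add_le
          exact abs_sub_le _ _ _
      _ = (∫⁻ x, ENNReal.ofReal |f x - b| ∂μ) + ENNReal.ofReal |b - m| * μ univ := by
          rw [lintegral_add_right _ measurable_const, lintegral_const]
      _ ≤ _ := by
          rw [two_mul]
          gcongr
  have hh : ∫⁻ x, ENNReal.ofReal |f x - g x| ∂μ ≤ 2 * R := by
    have hhm : AEMeasurable (fun x => |f x - g x|) μ := (hf.sub hgi).abs.aemeasurable
    rw [← rearrInt_univ hhm]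
    exact rearrInt_le_two_mul hhm ht (by linarith) le_rfl
  have hD : ∫⁻ x, gradModulus g x ∂μ ≤ 2 * R' := by
    have hDm := aemeasurable_toReal_gradModulus (μ := μ) hg
    have h1 := rearrInt_univ hDm
    simp only [ENNReal.ofReal_toReal (gradModulus_lt_top hg _).ne] at h1
    rw [← h1]
    exact rearrInt_le_two_mul hDm ht (by linarith) le_rfl
  have hIt := hI t ht
  have hI2 := hI (M / 2) ⟨by linarith, by linarith⟩
  have hgb : ∫⁻ x, ENNReal.ofReal |g x - b| ∂μ ≤
      2 * (ENNReal.ofReal (t / isoProfile μ t) * R') := by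
    have h1 := hμ.lintegral_sub_median_le hM hg
    -- The profile is largest at M/2, and t ≥ M/2.
    have h3 : M / 2 / isoProfile μ (M / 2) ≤ t / isoProfile μ t :=
      div_le_div₀ ht.1.le ht2 hIt (hμ.isoProfile_le_half (Ioo_subset_Icc_self ht))
    calc ∫⁻ x, ENNReal.ofReal |g x - b| ∂μ
        = ENNReal.ofReal (M / 2 / isoProfile μ (M / 2)) *
            (ENNReal.ofReal (isoProfile μ (M / 2) / (M / 2)) *
              ∫⁻ x, ENNReal.ofReal |g x - b| ∂μ) := by
          rw [← mul_assoc, ← ENNReal.ofReal_mul (div_nonneg (by linarith) hI2.le),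
            div_mul_div_cancel₀ hI2.ne', div_self (by linarith), ENNReal.ofReal_one, one_mul]
      _ ≤ ENNReal.ofReal (t / isoProfile μ t) * (2 * R') :=
          mul_le_mul' (ENNReal.ofReal_le_ofReal h3) (h1.trans hD)
      _ = _ := by ring
  calc ∫⁻ x, ENNReal.ofReal |f x - m| ∂μ ≤ 2 * ∫⁻ x, ENNReal.ofReal |f x - b| ∂μ := hfbm
    _ ≤ 2 * ∫⁻ x, (ENNReal.ofReal |f x - g x| + ENNReal.ofReal |g x - b|) ∂μ := by
        gcongr with x
        exact le_trans (ENNReal.ofReal_le_ofReal (abs_sub_le _ _ _)) ENNReal.ofReal_add_le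
    _ = 2 * ((∫⁻ x, ENNReal.ofReal |f x - g x| ∂μ) + ∫⁻ x, ENNReal.ofReal |g x - b| ∂μ) := by
        rw [lintegral_add_right _ (by fun_prop)]
    _ ≤ 2 * (2 * R + 2 * (ENNReal.ofReal (t / isoProfile μ t) * R')) := by gcongr
    _ = _ := by ring

variable [ConnectedSpace Ω]

theorem StandardAssumptions.signedRearrAvg_sub_le (hμ : StandardAssumptions μ)
    (hI : ∀ t ∈ Ioo 0 (μ.real univ), 0 < isoProfile μ t) {ρ : (Ω → ℝ≥0∞) → ℝ≥0∞}
    (hρ : IsRINorm μ ρ) {f : Ω → ℝ} (hf : Integrable f μ) {t : ℝ}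
    (ht : t ∈ Ioo 0 (μ.real univ / 2)) :
    ENNReal.ofReal (signedRearrAvg μ f t - signedRearr μ f t) ≤
      16 * (KFunctional ρ (t / isoProfile μ t) f / fundamentalFunction μ ρ t) := by
  refine hμ.le_KFunctional_div hρ hf.aemeasurable ⟨ht.1, by linarith [ht.1, ht.2]⟩ fun g hg => ?_
  refine (hμ.oscillation_le hI hf hg.1 (w := fun x => |f x - g x|) (measurable_norm.comp_aemeasurable
    (hf.aemeasurable.sub hg.1.continuous.measurable.aemeasurable)) (fun x => le_rfl)
    (aemeasurable_toReal_gradModulus hg.1) (fun x => ENNReal.toReal_nonneg)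
    (fun x => (ENNReal.ofReal_toReal (gradModulus_lt_top hg.1 x).ne).ge) ht).trans ?_
  rw [mul_add]
  gcongr <;> norm_num

theorem StandardAssumptions.decRearrAvg_sub_le (hμ : StandardAssumptions μ)
    (hI : ∀ t ∈ Ioo 0 (μ.real univ), 0 < isoProfile μ t) {ρ : (Ω → ℝ≥0∞) → ℝ≥0∞}
    (hρ : IsRINorm μ ρ) {f : Ω → ℝ} (hf : Integrable f μ) {t : ℝ}
    (ht : t ∈ Ioo 0 (μ.real univ)) :
    ENNReal.ofReal (decRearrAvg μ (fun x => f x - (∫ y, f y ∂μ) / μ.real univ) t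
        - decRearr μ (fun x => f x - (∫ y, f y ∂μ) / μ.real univ) t) ≤
      16 * (KFunctional ρ (t / isoProfile μ t) f / fundamentalFunction μ ρ t) := by
  refine hμ.le_KFunctional_div hρ hf.aemeasurable ht fun g hg => ?_
  have hgi := hμ.integrable_of_isLip hI hg.1
  have hmean := fun h => hμ.lintegral_sub_mean_le hI hf hg.1 ht h
  set m := (∫ y, f y ∂μ) / μ.real univ with hm
  have hu : Integrable (fun x => f x - m) μ := hf.sub (integrable_const m)
  rw [decRearrAvg_eq_signedRearrAvg hu.aemeasurable ht,
    decRearr_eq_signedRearr hu.aemeasurable ht]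
  rcases lt_or_ge t (μ.real univ / 2) with h | h
  -- The map y ↦ |y - m| is a contraction, so it increases neither |f - g| nor the gradient of `g`.
  · have hF : LipschitzWith 1 fun y : ℝ => |y - m| := by
      have h1 : LipschitzWith 1 fun y : ℝ => y - m := by
        simpa using LipschitzWith.id.sub (LipschitzWith.const m)
      simpa [Function.comp_def] using lipschitzWith_one_norm.comp h1
    refine (hμ.oscillation_le hI hu.abs (hg.1.comp hF) (w := fun x => |f x - g x|)
      (hf.sub hgi).abs.aemeasurable (fun x => ?_)
      (aemeasurable_toReal_gradModulus hg.1) (fun x => ENNReal.toReal_nonneg)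
      (fun x => (gradModulus_comp_le hF g x).trans
        (ENNReal.ofReal_toReal (gradModulus_lt_top hg.1 x).ne).ge) ⟨ht.1, h⟩).trans ?_
    · refine (abs_abs_sub_abs_le_abs_sub _ _).trans (le_of_eq ?_)
      congr 1
      ring
    · rw [mul_add]
      gcongr <;> norm_num
  -- For t ≥ M/2 the subtracted term is dropped and the whole mean oscillation is used.
  · rw [ofReal_mul_signedRearrAvg_sub hu.abs ht]
    have h0 : 0 ≤ signedRearr μ (fun x => |f x - m|) t :=
      signedRearr_nonneg hu.abs.aemeasurable (fun x => abs_nonneg _) ht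
    calc _ ≤ rearrInt μ (fun x => |f x - m|) t :=
          lintegral_mono fun s => ENNReal.ofReal_le_ofReal (by linarith)
      _ ≤ rearrInt μ (fun x => |f x - m|) (μ.real univ) := rearrInt_mono _ ht.2.le
      _ = ∫⁻ x, ENNReal.ofReal |f x - m| ∂μ := rearrInt_univ hu.abs.aemeasurable
      _ ≤ _ := hmean h
      _ ≤ _ := by
          gcongr
          norm_num

end Direct

/-! ### Cut-off functions and lower bounds for the perimeter. -/

section Converse

variable {Ω : Type*} [MetricSpace Ω]

theorem ConcaveOn.le_of_symm {F : ℝ → ℝ} {S : Set ℝ} (hF : ConcaveOn ℝ S F) {M s t : ℝ}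
    (hs : s ∈ S) (hs' : M - s ∈ S) (hsymm : F (M - s) = F s) (hst : s ≤ t) (ht : t ≤ M / 2) :
    F s ≤ F t := by
  have h := hF.min_le_of_mem_Icc hs hs' (z := t) ⟨hst, by linarith⟩
  rwa [hsymm, min_self] at h

/-- The cut-off function of `A` at distance `h`. -/
noncomputable def cutoff (A : Set Ω) (h : ℝ) (x : Ω) : ℝ := max (1 - Metric.infDist x A / h) 0

theorem cutoff_nonneg (A : Set Ω) (h : ℝ) (x : Ω) : 0 ≤ cutoff A h x := le_max_right _ _

theorem cutoff_le_one (A : Set Ω) {h : ℝ} (hh : 0 < h) (x : Ω) : cutoff A h x ≤ 1 := by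
  refine max_le ?_ zero_le_one
  linarith [div_nonneg (Metric.infDist_nonneg (x := x) (s := A)) hh.le]

theorem cutoff_eq_one {A : Set Ω} (h : ℝ) {x : Ω} (hx : x ∈ A) : cutoff A h x = 1 := by
  simp [cutoff, Metric.infDist_zero_of_mem hx]

theorem cutoff_eq_zero {A : Set Ω} (hA : A.Nonempty) {h : ℝ} (hh : 0 < h) {x : Ω}
    (hx : x ∉ Metric.thickening h A) : cutoff A h x = 0 := by
  rw [Metric.mem_thickening_iff_infDist_lt hA, not_lt] at hx
  refine max_eq_right ?_
  rw [sub_nonpos, one_le_div hh]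
  exact hx

theorem lipschitzWith_cutoff (A : Set Ω) {h : ℝ} (hh : 0 < h) :
    LipschitzWith (Real.toNNReal (1 / h)) (cutoff A h) := by
  refine LipschitzWith.max_const (LipschitzWith.of_dist_le_mul fun x y => ?_) 0
  have h1 := (Metric.lipschitz_infDist_pt A).dist_le_mul x y
  rw [NNReal.coe_one, one_mul, Real.dist_eq] at h1
  rw [Real.coe_toNNReal _ (by positivity), Real.dist_eq,
    show 1 - Metric.infDist x A / h - (1 - Metric.infDist y A / h) =
      -((Metric.infDist x A - Metric.infDist y A) / h) by ring, abs_neg, abs_div, abs_of_pos hh,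
    div_eq_mul_one_div, mul_comm]
  gcongr

theorem isLip_cutoff (A : Set Ω) {h : ℝ} (hh : 0 < h) : IsLip (cutoff A h) :=
  ⟨_, lipschitzWith_cutoff A hh⟩

variable [MeasurableSpace Ω] {μ : Measure Ω} [IsFiniteMeasure μ]

theorem IsLip.memS_normL1 {g : Ω → ℝ} (hg : IsLip g) : MemS (normL1 μ) g :=
  ⟨hg, hg.lintegral_gradModulus_lt_top⟩

theorem IsLip.KFunctional_normL1_le {g : Ω → ℝ} (hg : IsLip g) (τ : ℝ) :
    KFunctional (normL1 μ) τ g ≤ ENNReal.ofReal τ * ∫⁻ x, gradModulus g x ∂μ := by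
  refine iInf₂_le_of_le g hg.memS_normL1 ?_
  simp [normL1]

variable [BorelSpace Ω]

/-- The gradient is at most 1/h on A_h \ A; elsewhere the cut-off is 0 or 1, and the assumption on
level sets makes the gradient vanish almost everywhere. -/
theorem StandardAssumptions.lintegral_gradModulus_cutoff_le (hμ : StandardAssumptions μ)
    {A : Set Ω} (hA : A.Nonempty) (hAm : MeasurableSet A) {h : ℝ} (hh : 0 < h) :
    ∫⁻ x, gradModulus (cutoff A h) x ∂μ ≤
      (μ (Metric.thickening h A) - μ A) / ENNReal.ofReal h := by
  have hTm : MeasurableSet (Metric.thickening h A \ A) :=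
    Metric.isOpen_thickening.measurableSet.diff hAm
  calc ∫⁻ x, gradModulus (cutoff A h) x ∂μ
      ≤ ∫⁻ x, (Metric.thickening h A \ A).indicator (fun _ => ENNReal.ofReal (1 / h)) x ∂μ := by
        refine lintegral_mono_ae ?_
        filter_upwards [hμ.grad_level _ (isLip_cutoff A hh) 0,
          hμ.grad_level _ (isLip_cutoff A hh) 1] with x h0 h1
        by_cases hx : x ∈ Metric.thickening h A \ A
        · rw [indicator_of_mem hx]
          exact gradModulus_le (lipschitzWith_cutoff A hh) x
        · have : gradModulus (cutoff A h) x = 0 := by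
            by_cases hxA : x ∈ A
            · exact h1 (cutoff_eq_one h hxA)
            · exact h0 (cutoff_eq_zero hA hh fun hT => hx ⟨hT, hxA⟩)
          rw [this]
          exact zero_le
    _ = ENNReal.ofReal (1 / h) * μ (Metric.thickening h A \ A) := by
        rw [lintegral_indicator hTm, setLIntegral_const]
    _ = _ := by
        rw [measure_sdiff (Metric.self_subset_thickening hh A) hAm.nullMeasurableSet
          (measure_ne_top _ _), ENNReal.ofReal_div_of_pos hh, ENNReal.ofReal_one, one_div, mul_comm,
          ← div_eq_mul_inv]

theorem integrable_cutoff (A : Set Ω) {h : ℝ} (hh : 0 < h) : Integrable (cutoff A h) μ := by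
  refine Integrable.of_bound (C := 1)
    (isLip_cutoff A hh).continuous.measurable.aestronglyMeasurable (Eventually.of_forall fun x => ?_)
  rw [Real.norm_eq_abs, abs_of_nonneg (cutoff_nonneg A h x)]
  exact cutoff_le_one A hh x

theorem IsLip.memXAddS_normL1 {g : Ω → ℝ} (hg : IsLip g) : MemXAddS μ (normL1 μ) g :=
  ⟨hg.continuous.measurable.aemeasurable, g, hg.memS_normL1, by simp [normL1]⟩

/-- The oscillation inequality for cut-off functions bounds the perimeter from below. -/
theorem StandardAssumptions.le_perimeter (hμ : StandardAssumptions μ) {c γ t : ℝ} (hc : 0 < c)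
    (hγ : 0 < γ) (ht : t ∈ Ioo 0 (μ.real univ / 2))
    (H : ∀ f : Ω → ℝ, MemXAddS μ (normL1 μ) f → Integrable f μ →
      ENNReal.ofReal (signedRearrAvg μ f (2 * t) - signedRearr μ f (2 * t)) ≤
        ENNReal.ofReal c * (KFunctional (normL1 μ) (2 * t / γ) f / ENNReal.ofReal (2 * t)))
    {A : Set Ω} (hA : MeasurableSet A) (hAt : μ A = ENNReal.ofReal t) :
    ENNReal.ofReal (γ / (2 * c)) ≤ perimeter μ A := by
  obtain ⟨ht0, ht2⟩ := ht
  have h2t : 2 * t ∈ Ioo 0 (μ.real univ) := ⟨by linarith, by linarith⟩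
  have hAne : A.Nonempty := by
    refine nonempty_of_measure_ne_zero (μ := μ) ?_
    rw [hAt]
    exact (ENNReal.ofReal_pos.2 ht0).ne'
  have hδ : 0 < 2 * c * t / γ := by positivity
  refine le_liminf_of_le (by isBoundedDefault) ?_
  filter_upwards [Ioo_mem_nhdsGT hδ] with h hh
  -- If A_h has measure above 2t, the quotient exceeds t/h, which is large enough for h < 2ct/γ.
  -- Otherwise the cut-off has rearrangement at least 1 on (0, t) and at most 0 at 2t, so its
  -- oscillation at 2t is at least 1/2.
  rcases lt_or_ge (ENNReal.ofReal (2 * t)) (μ (Metric.thickening h A)) with hT | hT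
  · have h1 : ENNReal.ofReal t ≤ μ (Metric.thickening h A) - μ A := by
      rw [hAt]
      refine le_trans (le_of_eq ?_) (tsub_le_tsub_right hT.le _)
      rw [← ENNReal.ofReal_sub _ ht0.le]
      congr 1
      ring
    calc ENNReal.ofReal (γ / (2 * c)) ≤ ENNReal.ofReal (t / h) := by
          refine ENNReal.ofReal_le_ofReal ?_
          have := hh.2
          rw [lt_div_iff₀ hγ] at this
          rw [div_le_div_iff₀ (by positivity) hh.1]
          linarith
      _ = ENNReal.ofReal t / ENNReal.ofReal h := ENNReal.ofReal_div_of_pos hh.1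
      _ ≤ _ := ENNReal.div_le_div_right h1 _
  · set f := cutoff A h with hf
    have hfL : IsLip f := isLip_cutoff A hh.1
    have hfi : Integrable f μ := integrable_cutoff A hh.1
    set Q := (μ (Metric.thickening h A) - μ A) / ENNReal.ofReal h
    have hf2t : signedRearr μ f (2 * t) ≤ 0 := by
      rw [signedRearr_le_iff hfi.aemeasurable h2t]
      refine (measure_mono fun x hx => ?_).trans hT
      by_contra hn
      exact absurd (cutoff_eq_zero hAne hh.1 hn) (ne_of_gt hx)
    have hf1 : ∀ s ∈ Ioo 0 t, 1 ≤ signedRearr μ f s := by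
      intro s hs
      refine le_of_forall_lt fun y hy => ?_
      rw [lt_signedRearr_iff hfi.aemeasurable ⟨hs.1, by linarith [hs.2, h2t.2]⟩]
      calc ENNReal.ofReal s < ENNReal.ofReal t := (ENNReal.ofReal_lt_ofReal_iff ht0).2 hs.2
        _ = μ A := hAt.symm
        _ ≤ _ := measure_mono fun x hx => by
            rw [mem_ofPred_eq, hf, cutoff_eq_one h hx]
            exact hy
    have hosc : ENNReal.ofReal t ≤ ENNReal.ofReal (2 * t) *
        ENNReal.ofReal (signedRearrAvg μ f (2 * t) - signedRearr μ f (2 * t)) := by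
      rw [ofReal_mul_signedRearrAvg_sub hfi h2t]
      calc ENNReal.ofReal t = ∫⁻ _ in Ioo 0 t, 1 := by
            rw [setLIntegral_const, Real.volume_Ioo, sub_zero, one_mul]
        _ ≤ ∫⁻ s in Ioo 0 t, ENNReal.ofReal (signedRearr μ f s - signedRearr μ f (2 * t)) :=
            setLIntegral_mono' measurableSet_Ioo fun s hs => by
              rw [← ENNReal.ofReal_one]
              exact ENNReal.ofReal_le_ofReal (by linarith [hf1 s hs])
        _ ≤ _ := lintegral_mono_set (Ioo_subset_Ioo_right (by linarith))
    have hK : KFunctional (normL1 μ) (2 * t / γ) f ≤ ENNReal.ofReal (2 * t / γ) * Q :=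
      (hfL.KFunctional_normL1_le _).trans
        (mul_le_mul' le_rfl (hμ.lintegral_gradModulus_cutoff_le hAne hA hh.1))
    have hmain : ENNReal.ofReal t ≤ ENNReal.ofReal c * (ENNReal.ofReal (2 * t / γ) * Q) := by
      calc ENNReal.ofReal t ≤ ENNReal.ofReal (2 * t) * (ENNReal.ofReal c *
            (KFunctional (normL1 μ) (2 * t / γ) f / ENNReal.ofReal (2 * t))) :=
            hosc.trans (mul_le_mul' le_rfl (H f hfL.memXAddS_normL1 hfi))
        _ = ENNReal.ofReal c * (ENNReal.ofReal (2 * t) *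
            (KFunctional (normL1 μ) (2 * t / γ) f / ENNReal.ofReal (2 * t))) := by ring
        _ = ENNReal.ofReal c * KFunctional (normL1 μ) (2 * t / γ) f := by
            rw [ENNReal.mul_div_cancel (ENNReal.ofReal_pos.2 h2t.1).ne' ENNReal.ofReal_ne_top]
        _ ≤ _ := mul_le_mul' le_rfl hK
    calc ENNReal.ofReal (γ / (2 * c)) = ENNReal.ofReal (γ / (2 * c * t)) * ENNReal.ofReal t := by
          rw [← ENNReal.ofReal_mul (by positivity)]
          congr 1
          field_simp
      _ ≤ ENNReal.ofReal (γ / (2 * c * t)) *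
          (ENNReal.ofReal c * (ENNReal.ofReal (2 * t / γ) * Q)) := mul_le_mul' le_rfl hmain
      _ = Q := by
          rw [← mul_assoc, ← mul_assoc, ← ENNReal.ofReal_mul (by positivity),
            ← ENNReal.ofReal_mul (by positivity),
            show γ / (2 * c * t) * c * (2 * t / γ) = 1 by field_simp, ENNReal.ofReal_one, one_mul]

theorem StandardAssumptions.le_mul_isoProfile (hμ : StandardAssumptions μ) {c γ t : ℝ} (hc : 0 < c)
    (hγ : 0 ≤ γ) (ht : t ∈ Ioo 0 (μ.real univ / 2))
    (H : ∀ f : Ω → ℝ, MemXAddS μ (normL1 μ) f → Integrable f μ →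
      ENNReal.ofReal (signedRearrAvg μ f (2 * t) - signedRearr μ f (2 * t)) ≤
        ENNReal.ofReal c * (KFunctional (normL1 μ) (2 * t / γ) f / ENNReal.ofReal (2 * t))) :
    γ ≤ 2 * c * isoProfile μ t := by
  -- For γ = 0 the quotient 2t/γ is the default 0, but the claim is trivial.
  rcases hγ.eq_or_lt with rfl | hγ
  · exact mul_nonneg (by linarith) (isoProfile_nonneg t)
  have h1 : ENNReal.ofReal (γ / (2 * c)) ≤ isoProfileENN μ t :=
    le_iInf fun A => le_iInf fun hA => le_iInf fun hAt => hμ.le_perimeter hc hγ ht H hA hAt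
  rw [ENNReal.ofReal_le_iff_le_toReal (hμ.profile_finite t ⟨ht.1.le, by linarith [ht.1, ht.2]⟩),
    div_le_iff₀ (by linarith)] at h1
  rw [mul_comm]
  exact h1

end Converse

/-! ### Assembly, and extension of the converse bound to the whole interval. -/

theorem mainTheorem6 {Ω : Type*} [MetricSpace Ω] [ConnectedSpace Ω] [MeasurableSpace Ω]
    [BorelSpace Ω] (μ : Measure Ω) [IsFiniteMeasure μ] (hμ : StandardAssumptions μ) :
    -- (i), the profile being positive so that `t / I(t)` makes sense
    ((∀ t ∈ Ioo 0 (μ.real univ), 0 < isoProfile μ t) →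
      ∀ ρ : (Ω → ℝ≥0∞) → ℝ≥0∞, IsRINorm μ ρ → ∀ f : Ω → ℝ, MemXAddS μ ρ f →
        Integrable f μ ∧
        (∀ t ∈ Ioo 0 (μ.real univ / 2),
          ENNReal.ofReal (signedRearrAvg μ f t - signedRearr μ f t) ≤
            16 * (KFunctional ρ (t / isoProfile μ t) f / fundamentalFunction μ ρ t)) ∧
        (∀ t ∈ Ioo 0 (μ.real univ),
          ENNReal.ofReal
              (decRearrAvg μ (fun x => f x - (∫ y, f y ∂μ) / μ.real univ) t
                - decRearr μ (fun x => f x - (∫ y, f y ∂μ) / μ.real univ) t) ≤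
            16 * (KFunctional ρ (t / isoProfile μ t) f / fundamentalFunction μ ρ t))) ∧
    -- (ii)
    (∀ G : ℝ → ℝ, (∀ t ∈ Ioo 0 (μ.real univ), 0 ≤ G t) →
      ContinuousOn G (Ioo 0 (μ.real univ)) → ConcaveOn ℝ (Ioo 0 (μ.real univ)) G →
      (∀ t ∈ Ioo 0 (μ.real univ), G (μ.real univ - t) = G t) →
      (∃ c : ℝ, 0 < c ∧ ∀ f : Ω → ℝ, MemXAddS μ (normL1 μ) f → Integrable f μ →
        ∀ t ∈ Ioo 0 (μ.real univ / 2),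
          ENNReal.ofReal (signedRearrAvg μ f t - signedRearr μ f t) ≤
            ENNReal.ofReal c * (KFunctional (normL1 μ) (t / G t) f / ENNReal.ofReal t)) →
      ∃ c : ℝ, 0 < c ∧ ∀ t ∈ Ioo 0 (μ.real univ), G t ≤ c * isoProfile μ t) := by
  refine ⟨fun hI ρ hρ f hf => ?_, fun G hG0 _ hGc hGs ⟨c, hc, H⟩ => ⟨6 * c, by linarith, ?_⟩⟩
  · have hfi := hμ.integrable_of_memXAddS hI hρ hf
    exact ⟨hfi, fun t ht => hμ.signedRearrAvg_sub_le hI hρ hfi ht,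
      fun t ht => hμ.decRearrAvg_sub_le hI hρ hfi ht⟩
  set M := μ.real univ with hM
  have hmonoG : ∀ {s t : ℝ}, 0 < s → s ≤ t → t ≤ M / 2 → G s ≤ G t := fun {s t} h0 h1 h2 =>
    hGc.le_of_symm ⟨h0, by linarith⟩ ⟨by linarith, by linarith⟩ (hGs s ⟨h0, by linarith⟩) h1 h2
  have hmonoI : ∀ {s t : ℝ}, 0 < s → s ≤ t → t ≤ M / 2 → isoProfile μ s ≤ isoProfile μ t :=
    fun {s t} h0 h1 h2 => hμ.profile_concave.le_of_symm ⟨h0.le, by linarith⟩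
      ⟨by linarith, by linarith⟩ (hμ.profile_symm s ⟨h0.le, by linarith⟩) h1 h2
  have hsmall : ∀ t, 0 < t → t < M / 4 → G (2 * t) ≤ 2 * c * isoProfile μ t := fun t h0 h1 =>
    hμ.le_mul_isoProfile hc (hG0 _ ⟨by linarith, by linarith⟩) ⟨h0, by linarith⟩
      fun f hf hfi => H f hf hfi _ ⟨by linarith, by linarith⟩
  have hhalf : ∀ t, 0 < t → t ≤ M / 2 → G t ≤ 6 * c * isoProfile μ t := by
    intro t h0 h1
    have hIt := isoProfile_nonneg (μ := μ) t
    rcases lt_or_ge t (M / 4) with h | h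
    · have h2 := hsmall t h0 h
      have h3 := hmonoG h0 (t := 2 * t) (by linarith) (by linarith)
      nlinarith
    · have h2 := hsmall (M / 8) (by linarith) (by linarith)
      rw [show 2 * (M / 8) = M / 4 by ring] at h2
      -- Concavity with M/4 = (2/3)(M/8) + (1/3)(M/2) and G ≥ 0 gives G(M/2) ≤ 3G(M/4) ≤ 6c I(M/8),
      -- whence the constant 6c.
      have h3 := hGc.2 (show M / 8 ∈ Ioo 0 M from ⟨by linarith, by linarith⟩)
        (show M / 2 ∈ Ioo 0 M from ⟨by linarith, by linarith⟩) (show (0 : ℝ) ≤ 2 / 3 by norm_num)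
        (show (0 : ℝ) ≤ 1 / 3 by norm_num) (by norm_num)
      simp only [smul_eq_mul] at h3
      rw [show 2 / 3 * (M / 8) + 1 / 3 * (M / 2) = M / 4 by ring] at h3
      have h4 := hG0 (M / 8) ⟨by linarith, by linarith⟩
      have h5 := hmonoG h0 h1 le_rfl
      have h6 := hmonoI (s := M / 8) (by linarith) (show M / 8 ≤ t by linarith) h1
      nlinarith
  intro t ht
  rcases le_total t (M / 2) with h | h
  · exact hhalf t ht.1 h
  · rw [← hGs t ht, ← hμ.profile_symm t (Ioo_subset_Icc_self ht)]
    exact hhalf _ (by linarith [ht.2]) (by linarith)
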